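/- Let $X,Y$ be separable real Hilbert spaces, $A:X\to Y$ a bounded linear operator, and $\Sigma$ a self-adjoint, positive definite, trace class operator on $X$. Real powers of $\Sigma$ (and of other injective positive compact operators) are defined by spectral calculus, as possibly unbounded operators, and $\|x\|_r=\|\Sigma^{r/2}x\|$. Assume that there are constants $C>1$, $\nu>0$ with $$C^{-1}\|x\|_\nu\le\|Ax\|\le C\|x\|_\nu\qquad(x\in X).$$ Let $0\le s\le\nu+2$, and let $u_0,u^\dagger\in X$ satisfy $u_0-u^\dagger\in\mathrm{Dom}(\Sigma^{-s/2})$. Let $\alpha>0$, $\gamma\in\mathbb R$, and let $\eta_1,\eta_2,\dots$ be independent Gaussian white noises $N(0,\gamma^2I)$ on $Y$, that is, centered Gaussian families $\langle\eta_k,\varphi\rangle$, $\varphi\in Y$, with $\mathbb E[\langle\eta_k,\varphi\rangle\langle\eta_k,\psi\rangle]=\gamma^2\langle\varphi,\psi\rangle$. The data are $y_n=Au^\dagger+\eta_n$, and the 3DVAR iteration and its iterate average are $$u_n=\mathcal K y_n+(I-\mathcal K A)u_{n-1},\quad \mathcal K=(A^*A+\alpha\Sigma^{-1})^{-1}A^*,\qquad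 \bar u_n=\frac1n\sum_{k=1}^n u_k ,$$ where $\mathcal K\eta_n$ is the $X$-valued random variable with $\langle x,\mathcal K\eta_n\rangle=\langle\eta_n,\mathcal K^*x\rangle$ almost surely for each $x\in X$. Fix $t\in[0,\nu]$ and $\tau_{\rm v}\in[0,1]$ such that $\Sigma^{t+1-\tau_{\rm v}(1+\nu)}$ is (bounded and) trace class. Put $B=A\Sigma^{1/2}$. Then the bounded operator $\mathcal K$ and the iterates $u_n$ are well defined, the equation $$\Sigma^{-1/2}(u_0-u^\dagger)=(B^*B)^{\frac{s-1}{2(1+\nu)}}z_0$$ has exactly one solution $z_0\in X$ (for $s<1$ it is understood in the Hilbert scale, by duality, i.e. $\langle u_0-u^\dagger,\psi\rangle=\langle z_0,(B^*B)^{\frac{s-1}{2(1+\nu)}}\Sigma^{1/2}\psi\rangle$ for all $\psi\in X$), and for all $n\ge1$ $$\mathbb E\big[\|\bar u_n-u^\dagger\|_t^2\big]\le K\left\{\Big(\frac n\alpha\Big)^{-\frac{s+t}{1+\nu}}\|z_0\|^2+\frac{\gamma^2}{\alpha}\,\mathrm{Tr}\big(\Sigma^{t+1-\tau_{\rm v}(1+\nu)}\big)\Big(\frac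 n\alpha\Big)^{-\tau_{\rm v}}\right\},$$ where the constant $K>0$ depends only on $C,\nu,s,t,\tau_{\rm v}$. -/

import Mathlib

open MeasureTheory ProbabilityTheory
open scoped InnerProductSpace

namespace ThreeDVAR

noncomputable section

/-! ### Spectral calculus: real powers of a positive compact operator

If `T` is self-adjoint, positive and compact, then `X` is the closed orthogonal sum of the
eigenspaces `ker (T - μ)`, and `T ^ p` is the (possibly unbounded) operator
`x ↦ ∑_μ μ ^ p P_μ x`, whose domain consists of those `x` for which the series converges. -/

section Powers

variable {X : Type*} [NormedAddCommGroup X] [InnerProductSpace ℝ X] [CompleteSpace X]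

/-- Orthogonal projection onto `ker (T - μ)`; it vanishes unless `μ` is an eigenvalue. -/
def eigenProj (T : X →L[ℝ] X) (μ : ℝ) : X →L[ℝ] X :=
  (T - μ • ContinuousLinearMap.id ℝ X).ker.starProjection

/-- The domain of `T ^ p`. -/
def powDom (T : X →L[ℝ] X) (p : ℝ) : Set X :=
  {x | Summable fun μ : ℝ => μ ^ p • eigenProj T μ x}

/-- The value `T ^ p x`, for `x` in the domain `powDom T p`. -/
def powApply (T : X →L[ℝ] X) (p : ℝ) (x : X) : X :=
  ∑' μ : ℝ, μ ^ p • eigenProj T μ x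

/-- `T ^ p` is everywhere defined and equal to the bounded operator `R`. -/
def IsBoundedPow (T : X →L[ℝ] X) (p : ℝ) (R : X →L[ℝ] X) : Prop :=
  ∀ x, x ∈ powDom T p ∧ R x = powApply T p x

open Classical in
/-- `T ^ p` as a bounded operator, whenever it is one. This is so if `T` is positive and `0 ≤ p`,
see `boundedPow_spec`. -/
def boundedPow (T : X →L[ℝ] X) (p : ℝ) : X →L[ℝ] X :=
  if h : ∃ R, IsBoundedPow T p R then h.choose else 0

theorem mem_ker_iff {X : Type*} [NormedAddCommGroup X] [InnerProductSpace ℝ X]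
    (T : X →L[ℝ] X) (μ : ℝ) (v : X) :
    v ∈ (T - μ • ContinuousLinearMap.id ℝ X).ker ↔ T v = μ • v := by
  simp [LinearMap.mem_ker, sub_eq_zero]

theorem apply_eigenProj (T : X →L[ℝ] X) (μ : ℝ) (x : X) :
    T (eigenProj T μ x) = μ • eigenProj T μ x :=
  (mem_ker_iff T μ _).1 (Submodule.starProjection_apply_mem _ x)

theorem inner_eigenProj_self (T : X →L[ℝ] X) (μ : ℝ) (x : X) :
    ⟪eigenProj T μ x, x⟫_ℝ = ‖eigenProj T μ x‖ ^ 2 := by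
  have hm : eigenProj T μ x ∈ (T - μ • ContinuousLinearMap.id ℝ X).ker :=
    Submodule.starProjection_apply_mem _ x
  have h : ⟪eigenProj T μ x, x - eigenProj T μ x⟫_ℝ = 0 :=
    Submodule.inner_right_of_mem_orthogonal hm (Submodule.sub_starProjection_mem_orthogonal x)
  rw [inner_sub_right, real_inner_self_eq_norm_sq] at h
  linarith

theorem orthogonalFamily_ker {T : X →L[ℝ] X} (hT : T.IsPositive) :
    OrthogonalFamily ℝ (fun μ : ℝ => (T - μ • ContinuousLinearMap.id ℝ X).ker)
      fun μ => (T - μ • ContinuousLinearMap.id ℝ X).ker.subtypeₗᵢ := by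
  rintro μ μ' hne ⟨v, hv⟩ ⟨w, hw⟩
  rw [mem_ker_iff] at hv hw
  have h : ⟪T v, w⟫_ℝ = ⟪v, T w⟫_ℝ := hT.isSymmetric v w
  rw [hv, hw, real_inner_smul_left, real_inner_smul_right] at h
  have h' : (μ - μ') * ⟪v, w⟫_ℝ = 0 := by linarith
  exact (mul_eq_zero.1 h').resolve_left (sub_ne_zero.2 hne)

theorem boundedPow_aux {T : X →L[ℝ] X} (hT : T.IsPositive) {p : ℝ} (hp : 0 ≤ p) (x : X) :
    x ∈ powDom T p ∧ ‖powApply T p x‖ ≤ ‖T‖ ^ p * ‖x‖ := by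
  have hV := orthogonalFamily_ker hT
  have hmem : ∀ μ, eigenProj T μ x ∈ (T - μ • ContinuousLinearMap.id ℝ X).ker := fun μ =>
    Submodule.starProjection_apply_mem _ x
  have hcoef : ∀ μ : ℝ, ‖μ ^ p • eigenProj T μ x‖ ^ 2 ≤
      (‖T‖ ^ p) ^ 2 * ‖eigenProj T μ x‖ ^ 2 := by
    intro μ
    by_cases h0 : eigenProj T μ x = 0
    · simp [h0]
    have hpos : 0 < ‖eigenProj T μ x‖ := norm_pos_iff.2 h0
    have he := apply_eigenProj T μ x
    have hμ0 : 0 ≤ μ := by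
      have h1 : 0 ≤ ⟪T (eigenProj T μ x), eigenProj T μ x⟫_ℝ := hT.inner_nonneg_left _
      rw [he, real_inner_smul_left, real_inner_self_eq_norm_sq] at h1
      by_contra hneg
      nlinarith [pow_pos hpos 2]
    have hμ1 : μ ≤ ‖T‖ := by
      have h1 := T.le_opNorm (eigenProj T μ x)
      rw [he, norm_smul, Real.norm_of_nonneg hμ0] at h1
      exact le_of_mul_le_mul_right h1 hpos
    rw [norm_smul, mul_pow, Real.norm_of_nonneg (Real.rpow_nonneg hμ0 p)]
    have := Real.rpow_le_rpow hμ0 hμ1 hp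
    gcongr
  have hbes : ∀ s : Finset ℝ, ∑ μ ∈ s, ‖eigenProj T μ x‖ ^ 2 ≤ ‖x‖ ^ 2 := by
    intro s
    have hn := hV.norm_sum (fun μ => ⟨eigenProj T μ x, hmem μ⟩) s
    simp only [Submodule.coe_subtypeₗᵢ, Submodule.subtype_apply, Submodule.coe_norm] at hn
    have hi : ⟪∑ μ ∈ s, eigenProj T μ x, x⟫_ℝ = ∑ μ ∈ s, ‖eigenProj T μ x‖ ^ 2 := by
      rw [sum_inner]
      exact Finset.sum_congr rfl fun μ _ => inner_eigenProj_self T μ x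
    have hc := real_inner_le_norm (∑ μ ∈ s, eigenProj T μ x) x
    rw [hi, ← hn] at hc
    rw [← hn]
    nlinarith [norm_nonneg (∑ μ ∈ s, eigenProj T μ x), norm_nonneg x,
      sq_nonneg (‖∑ μ ∈ s, eigenProj T μ x‖ - ‖x‖)]
  have hfin : ∀ s : Finset ℝ, ∑ μ ∈ s, ‖μ ^ p • eigenProj T μ x‖ ^ 2 ≤
      (‖T‖ ^ p * ‖x‖) ^ 2 := by
    intro s
    calc ∑ μ ∈ s, ‖μ ^ p • eigenProj T μ x‖ ^ 2
        ≤ ∑ μ ∈ s, (‖T‖ ^ p) ^ 2 * ‖eigenProj T μ x‖ ^ 2 := Finset.sum_le_sum fun μ _ => hcoef μ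
      _ = (‖T‖ ^ p) ^ 2 * ∑ μ ∈ s, ‖eigenProj T μ x‖ ^ 2 := by rw [Finset.mul_sum]
      _ ≤ (‖T‖ ^ p) ^ 2 * ‖x‖ ^ 2 := by gcongr; exact hbes s
      _ = (‖T‖ ^ p * ‖x‖) ^ 2 := by ring
  have hsum : Summable fun μ : ℝ => μ ^ p • eigenProj T μ x := by
    have := (hV.summable_iff_norm_sq_summable
      (fun μ => ⟨μ ^ p • eigenProj T μ x, Submodule.smul_mem _ _ (hmem μ)⟩)).2
      (summable_of_sum_le (fun μ => by positivity) hfin)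
    exact this
  refine ⟨hsum, ?_⟩
  refine le_of_tendsto hsum.hasSum.norm (Filter.Eventually.of_forall fun s => ?_)
  have hn := hV.norm_sum
    (fun μ => ⟨μ ^ p • eigenProj T μ x, Submodule.smul_mem _ _ (hmem μ)⟩) s
  simp only [Submodule.coe_subtypeₗᵢ, Submodule.subtype_apply, Submodule.coe_norm] at hn
  refine abs_le_of_sq_le_sq' ?_ (by positivity) |>.2
  rw [hn]
  exact hfin s

/-- Nonnegative powers of a positive operator are bounded and everywhere defined. -/
theorem boundedPow_spec {T : X →L[ℝ] X} (hT : T.IsPositive) {p : ℝ} (hp : 0 ≤ p) :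
    IsBoundedPow T p (boundedPow T p) := by
  have h : ∃ R, IsBoundedPow T p R := by
    let L : X →ₗ[ℝ] X :=
      { toFun := powApply T p
        map_add' := fun x y => by
          have hx : Summable fun μ : ℝ => μ ^ p • eigenProj T μ x := (boundedPow_aux hT hp x).1
          have hy : Summable fun μ : ℝ => μ ^ p • eigenProj T μ y := (boundedPow_aux hT hp y).1
          simp only [powApply, map_add, smul_add]
          exact hx.tsum_add hy
        map_smul' := fun c x => by
          have hx : Summable fun μ : ℝ => μ ^ p • eigenProj T μ x := (boundedPow_aux hT hp x).1
          simp only [powApply, map_smul, RingHom.id_apply]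
          rw [← hx.tsum_const_smul c]
          exact tsum_congr fun μ => smul_comm _ _ _ }
    exact ⟨L.mkContinuous (‖T‖ ^ p) fun x => (boundedPow_aux hT hp x).2,
      fun x => ⟨(boundedPow_aux hT hp x).1, rfl⟩⟩
  rw [boundedPow, dif_pos h]
  exact h.choose_spec

theorem inner_boundedPow {T : X →L[ℝ] X} (hT : T.IsPositive) {p : ℝ} (hp : 0 ≤ p) (x y : X) :
    ⟪boundedPow T p x, y⟫_ℝ = ⟪x, boundedPow T p y⟫_ℝ := by
  have hx : Summable fun μ : ℝ => μ ^ p • eigenProj T μ x := (boundedPow_spec hT hp x).1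
  have hy : Summable fun μ : ℝ => μ ^ p • eigenProj T μ y := (boundedPow_spec hT hp y).1
  rw [(boundedPow_spec hT hp x).2, (boundedPow_spec hT hp y).2, powApply, powApply,
    real_inner_comm, ← innerSL_apply_apply ℝ y, ← innerSL_apply_apply ℝ x,
    (innerSL ℝ y).map_tsum hx, (innerSL ℝ x).map_tsum hy]
  refine tsum_congr fun μ => ?_
  rw [innerSL_apply_apply, innerSL_apply_apply, real_inner_smul_right, real_inner_smul_right,
    real_inner_comm]
  congr 1
  exact Submodule.inner_starProjection_left_eq_right _ x y

/-- The norm `‖x‖_t = ‖T ^ (t / 2) x‖` of the Hilbert scale. -/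
def scaleNorm (T : X →L[ℝ] X) (t : ℝ) (x : X) : ℝ := ‖powApply T (t / 2) x‖

end Powers

/-! ### Trace class -/

section Trace

variable {X : Type*} [NormedAddCommGroup X] [InnerProductSpace ℝ X] [CompleteSpace X]

/-- A positive bounded operator is trace class if its diagonal is summable in every orthonormal
basis (for a positive operator the sum does not depend on the basis). -/
def IsPositiveTraceClass (T : X →L[ℝ] X) : Prop :=
  T.IsPositive ∧ ∀ (w : Set X) (b : HilbertBasis w ℝ X), Summable fun i => ⟪b i, T (b i)⟫_ℝ

variable (X) in
/-- Index set of some orthonormal basis of `X`. -/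
def basisIndex : Set X := (exists_hilbertBasis ℝ X).choose

variable (X) in
/-- Some orthonormal basis of `X`. -/
def someBasis : HilbertBasis (basisIndex X) ℝ X := (exists_hilbertBasis ℝ X).choose_spec.choose

/-- The trace of a positive trace class operator. -/
def opTrace (T : X →L[ℝ] X) : ℝ := ∑' i, ⟪someBasis X i, T (someBasis X i)⟫_ℝ

/-- `T ^ p` is a bounded trace class operator. Its trace is then `opTrace (boundedPow T p)`. -/
def IsTraceClassPow (T : X →L[ℝ] X) (p : ℝ) : Prop :=
  ∃ R, IsBoundedPow T p R ∧ IsPositiveTraceClass R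

end Trace

/-! ### The inverse problem and the filter -/

section Filter

variable {X Y Ω : Type*} [NormedAddCommGroup X] [InnerProductSpace ℝ X] [CompleteSpace X]
  [NormedAddCommGroup Y] [InnerProductSpace ℝ Y] [CompleteSpace Y]

/-- `S` is a self-adjoint positive definite trace class operator, and `A` induces a norm equivalent
to the norm `‖·‖_ν` of the Hilbert scale of `S`, with constant `C`. -/
structure HilbertScaleLink (A : X →L[ℝ] Y) (S : X →L[ℝ] X) (C ν : ℝ) : Prop where
  traceClass : IsPositiveTraceClass S
  posDef : ∀ x, x ≠ 0 → 0 < ⟪S x, x⟫_ℝ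
  lower : ∀ x, C⁻¹ * scaleNorm S ν x ≤ ‖A x‖
  upper : ∀ x, ‖A x‖ ≤ C * scaleNorm S ν x

/-- `B = A S ^ (1/2)`. -/
def opB (A : X →L[ℝ] Y) (S : X →L[ℝ] X) : X →L[ℝ] Y := A ∘L boundedPow S (1 / 2)

/-- `B* B`. -/
def opBB (A : X →L[ℝ] Y) (S : X →L[ℝ] X) : X →L[ℝ] X :=
  ContinuousLinearMap.adjoint (opB A S) ∘L opB A S

/-- `z` solves `S ^ (-1/2) v = (B* B) ^ ((s - 1) / (2 (1 + ν))) z` in the Hilbert scale.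
For `s < 1` the vector `v` need not lie in the domain of `S ^ (-1/2)` and the exponent on the right
is negative, so that both sides are elements of a negative order space of the scale, which is
realized by duality: the equation is tested against the elements `S ^ (1/2) ψ` of the domain of
`S ^ (-1/2)`, and the self-adjoint operators `S ^ (-1/2)` and `(B* B) ^ ρ` are moved to the test
element. For `1 ≤ s` this says that `v = S ^ (1/2) (B* B) ^ ρ z`, see `solvesAux_iff`. -/
def SolvesAux (A : X →L[ℝ] Y) (S : X →L[ℝ] X) (ν s : ℝ) (v z : X) : Prop :=
  ∀ ψ : X, boundedPow S (1 / 2) ψ ∈ powDom (opBB A S) ((s - 1) / (2 * (1 + ν))) ∧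
    ⟪v, ψ⟫_ℝ =
      ⟪z, powApply (opBB A S) ((s - 1) / (2 * (1 + ν))) (boundedPow S (1 / 2) ψ)⟫_ℝ

theorem solvesAux_iff (A : X →L[ℝ] Y) {S : X →L[ℝ] X} (hS : S.IsPositive) {ν s : ℝ} (hν : 0 < ν)
    (hs : 1 ≤ s) (v z : X) :
    SolvesAux A S ν s v z ↔
      v = boundedPow S (1 / 2) (powApply (opBB A S) ((s - 1) / (2 * (1 + ν))) z) := by
  have hB : (opBB A S).IsPositive := ContinuousLinearMap.isPositive_adjoint_comp_self _
  have hρ : 0 ≤ (s - 1) / (2 * (1 + ν)) := div_nonneg (by linarith) (by positivity)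
  have hspec := boundedPow_spec hB hρ
  have hmove : ∀ ψ, ⟪z, powApply (opBB A S) ((s - 1) / (2 * (1 + ν))) (boundedPow S (1 / 2) ψ)⟫_ℝ =
      ⟪boundedPow S (1 / 2) (powApply (opBB A S) ((s - 1) / (2 * (1 + ν))) z), ψ⟫_ℝ := by
    intro ψ
    rw [← (hspec _).2, ← (hspec _).2, inner_boundedPow hS (by norm_num), inner_boundedPow hB hρ]
  constructor
  · intro h
    exact ext_inner_right ℝ fun ψ => ((h ψ).2).trans (hmove ψ)
  · intro h ψ
    exact ⟨(hspec _).1, by rw [hmove ψ, ← h]⟩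

/-- `G = (A* A + α S⁻¹)⁻¹ A*`: for every `y`, the vector `G y` lies in the domain of `S⁻¹` and
`(A* A + α S⁻¹) (G y) = A* y`. -/
def IsGain (A : X →L[ℝ] Y) (S : X →L[ℝ] X) (α : ℝ) (G : Y →L[ℝ] X) : Prop :=
  ∀ y, G y ∈ powDom S (-1) ∧
    ContinuousLinearMap.adjoint A (A (G y)) + α • powApply S (-1) (G y) =
      ContinuousLinearMap.adjoint A y

variable [MeasurableSpace Ω]

/-- Gaussian white noise `N(0, γ² I)` on `Y`. In infinite dimensions it is not a random vector of
`Y`; it is the centered Gaussian family `ξ φ`, standing for `⟨ξ, φ⟩`, with covariance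
`E[⟨ξ, φ⟩ ⟨ξ, ψ⟩] = γ² ⟨φ, ψ⟩`. -/
structure IsWhiteNoise (P : Measure Ω) (γ : ℝ) (ξ : Y → Ω → ℝ) : Prop where
  measurable : ∀ φ, Measurable (ξ φ)
  gaussian : IsGaussianProcess ξ P
  mean : ∀ φ, ∫ ω, ξ φ ω ∂P = 0
  cov : ∀ φ ψ, ∫ ω, ξ φ ω * ξ ψ ω ∂P = γ ^ 2 * ⟪φ, ψ⟫_ℝ

/-- Independent white noises `N(0, γ² I)`. The entry `η k` is the noise of step `k + 1`. -/
structure IsIIDWhiteNoise (P : Measure Ω) (γ : ℝ) (η : ℕ → Y → Ω → ℝ) : Prop where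
  whiteNoise : ∀ k, IsWhiteNoise P γ (η k)
  indep : iIndepFun (fun k ω φ => η k φ ω) P

/-- The data `y_{k+1} = A u† + η_{k+1}`, as generalized random elements of `Y`. -/
def observation (A : X →L[ℝ] Y) (uTrue : X) (η : ℕ → Y → Ω → ℝ) (k : ℕ) (φ : Y) (ω : Ω) : ℝ :=
  ⟪A uTrue, φ⟫_ℝ + η k φ ω

/-- The sequence `u_{n+1} = G y_{n+1} + (I - G A) u_n` of random vectors of `X`, started at `u₀`.
The random vector `G y` is the one with `⟨x, G y⟩ = ⟨G* x, y⟩` almost surely, for every `x`. -/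
structure IsFilterSequence (P : Measure Ω) (A : X →L[ℝ] Y) (G : Y →L[ℝ] X)
    (y : ℕ → Y → Ω → ℝ) (u₀ : X) (u : ℕ → Ω → X) : Prop where
  measurable : ∀ n, AEStronglyMeasurable (u n) P
  init : ∀ᵐ ω ∂P, u 0 ω = u₀
  step : ∀ (n : ℕ) (x : X), ∀ᵐ ω ∂P,
    ⟪x, u (n + 1) ω⟫_ℝ =
      y n (ContinuousLinearMap.adjoint G x) ω + ⟪x, u n ω - G (A (u n ω))⟫_ℝ

/-- The iterate average `(u_1 + ⋯ + u_n) / n`. -/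
def iterAvg (u : ℕ → Ω → X) (n : ℕ) (ω : Ω) : X :=
  (n : ℝ)⁻¹ • ∑ k ∈ Finset.Icc 1 n, u k ω

end Filter

end

end ThreeDVAR

open ThreeDVAR

set_option linter.unusedSectionVars false

/-! Write `H = B* B` with `B = A S ^ (1/2)`. The gain is `G = S ^ (1/2) (H + α)⁻¹ B*`, and the
adjoint `L` of the transition operator `I - G A` satisfies `S ^ (1/2) L = α (H + α)⁻¹ S ^ (1/2)`.
Once `S ^ (1/2)` is applied, every power of `L` is thus a function of `H`, and estimates reduce to
scalar ones on the spectrum of `H`.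

The averaged error tested against `x` is a bias term, the pairing of `u₀ - u†` with the mean of `L ^
k x`, plus `n⁻¹` times a sum of independent noises evaluated at `G* (∑ L ^ i) x`. The bias
multiplier, the mean of `(α / (μ + α)) ^ k`, is at most `1` and at most `α / (n μ)`. The noise
multiplier is at most `1 / μ` and at most `n / α`. Interpolating within each pair gives the stated
powers of `n / α` (`bias_scalar_le`, `variance_scalar_le`).

It remains to trade powers of `S` for powers of `H`. The link condition says that `S ^ ((1 + ν) /
2)` and `H ^ (1/2)` have equivalent norms. The Heinz inequality (`IsInjDiag.heinz`), proved by the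
three lines theorem, passes this to smaller powers, and Douglas' lemma turns it into `S ^ r = H ^ (r
/ (1 + ν)) E` with `‖E x‖ ≤ 4 C ‖x‖` (`HilbertScaleLink.exists_factor`). The same factorization
solves the equation for `z₀`. Summing second moments over an eigenbasis of `S` with weights `l ^ t`
produces the trace. -/

namespace ThreeDVAR

open Filter Topology MeasureTheory ProbabilityTheory
open scoped InnerProductSpace

/-! ### Spectral calculus on eigenspaces -/

section Calculus

variable {X : Type*} [NormedAddCommGroup X] [InnerProductSpace ℝ X] [CompleteSpace X]

/-- `T` is positive and injective, and its eigenspaces span a dense subspace. -/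
structure IsInjDiag (T : X →L[ℝ] X) : Prop where
  pos : T.IsPositive
  inj : ∀ x, T x = 0 → x = 0
  total : ∀ x, (∀ μ, eigenProj T μ x = 0) → x = 0

theorem eigenProj_mem (T : X →L[ℝ] X) (μ : ℝ) (x : X) :
    eigenProj T μ x ∈ (T - μ • ContinuousLinearMap.id ℝ X).ker :=
  Submodule.starProjection_apply_mem _ x

theorem inner_eigenProj_comm (T : X →L[ℝ] X) (μ : ℝ) (x y : X) :
    ⟪eigenProj T μ x, y⟫_ℝ = ⟪x, eigenProj T μ y⟫_ℝ :=
  Submodule.inner_starProjection_left_eq_right _ x y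

theorem eigenProj_of_eigenvector {T : X →L[ℝ] X} {μ : ℝ} {x : X} (h : T x = μ • x) :
    eigenProj T μ x = x :=
  Submodule.starProjection_eq_self_iff.2 ((mem_ker_iff T μ x).2 h)

theorem eigenProj_of_eigenvector_ne {T : X →L[ℝ] X} (hT : T.IsPositive) {μ l : ℝ} (hne : l ≠ μ)
    {x : X} (h : T x = μ • x) : eigenProj T l x = 0 := by
  refine ext_inner_right ℝ fun y => ?_
  rw [inner_eigenProj_comm, inner_zero_left]
  exact orthogonalFamily_ker hT hne.symm ⟨x, (mem_ker_iff T μ x).2 h⟩ ⟨_, eigenProj_mem T l y⟩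

theorem eigenProj_apply {T : X →L[ℝ] X} (hT : T.IsPositive) (μ : ℝ) (x : X) :
    eigenProj T μ (T x) = μ • eigenProj T μ x := by
  refine ext_inner_right ℝ fun y => ?_
  have h : ⟪T x, eigenProj T μ y⟫_ℝ = ⟪x, T (eigenProj T μ y)⟫_ℝ := hT.isSymmetric _ _
  rw [inner_eigenProj_comm, h, apply_eigenProj, real_inner_smul_right, real_inner_smul_left,
    inner_eigenProj_comm]

theorem sum_norm_sq_eigenProj_le {T : X →L[ℝ] X} (hT : T.IsPositive) (x : X) (s : Finset ℝ) :
    ∑ μ ∈ s, ‖eigenProj T μ x‖ ^ 2 ≤ ‖x‖ ^ 2 := by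
  have hn := (orthogonalFamily_ker hT).norm_sum (fun μ => ⟨eigenProj T μ x, eigenProj_mem T μ x⟩) s
  simp only [Submodule.coe_subtypeₗᵢ, Submodule.subtype_apply, Submodule.coe_norm] at hn
  have hi : ⟪∑ μ ∈ s, eigenProj T μ x, x⟫_ℝ = ∑ μ ∈ s, ‖eigenProj T μ x‖ ^ 2 := by
    rw [sum_inner]
    exact Finset.sum_congr rfl fun μ _ => inner_eigenProj_self T μ x
  have hc := real_inner_le_norm (∑ μ ∈ s, eigenProj T μ x) x
  rw [hi, ← hn] at hc
  rw [← hn]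
  nlinarith [norm_nonneg (∑ μ ∈ s, eigenProj T μ x), norm_nonneg x,
    sq_nonneg (‖∑ μ ∈ s, eigenProj T μ x‖ - ‖x‖)]

/-- The eigenprojection of a series of eigenvectors is the corresponding term. -/
theorem eigenProj_hasSum {T : X →L[ℝ] X} (hT : T.IsPositive) {f : ℝ → X}
    (hf : ∀ μ, T (f μ) = μ • f μ) {y : X} (hy : HasSum f y) (μ : ℝ) : eigenProj T μ y = f μ := by
  have h1 := hy.mapL (eigenProj T μ)
  have h2 : HasSum (fun l => eigenProj T μ (f l)) (f μ) := by
    have := hasSum_single (f := fun l => eigenProj T μ (f l)) μ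
      fun l hl => eigenProj_of_eigenvector_ne hT hl.symm (hf l)
    rwa [eigenProj_of_eigenvector (hf μ)] at this
  exact h1.unique h2

namespace IsInjDiag

variable {T : X →L[ℝ] X}

theorem ext (hT : IsInjDiag T) {x y : X} (h : ∀ μ, eigenProj T μ x = eigenProj T μ y) : x = y :=
  sub_eq_zero.1 <| hT.total _ fun μ => by rw [map_sub, h, sub_self]

/-- Bessel's inequality gives convergence; the limit has the same components as `x`, and totality
identifies the two. -/
theorem hasSum (hT : IsInjDiag T) (x : X) : HasSum (fun μ => eigenProj T μ x) x := by
  have hs : Summable fun μ => eigenProj T μ x :=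
    ((orthogonalFamily_ker hT.pos).summable_iff_norm_sq_summable
      (fun μ => ⟨eigenProj T μ x, eigenProj_mem T μ x⟩)).2
      (summable_of_sum_le (fun μ => by positivity) (sum_norm_sq_eigenProj_le hT.pos x))
  have h : ∑' μ, eigenProj T μ x = x :=
    hT.ext fun μ => eigenProj_hasSum hT.pos (fun l => apply_eigenProj T l x) hs.hasSum μ
  simpa [h] using hs.hasSum

theorem hasSum_norm_sq (hT : IsInjDiag T) (x : X) :
    HasSum (fun μ => ‖eigenProj T μ x‖ ^ 2) (‖x‖ ^ 2) := by
  have h := (hT.hasSum x).mapL (innerSL ℝ x)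
  simpa only [innerSL_apply_apply, real_inner_self_eq_norm_sq, ← inner_eigenProj_comm,
    inner_eigenProj_self] using h

/-- Powers are summed over all real `μ`; this makes the conventional values of `μ ^ p` for `μ ≤ 0`
irrelevant. -/
theorem eigenProj_of_nonpos (hT : IsInjDiag T) {μ : ℝ} (hμ : μ ≤ 0) (x : X) :
    eigenProj T μ x = 0 := by
  have he := apply_eigenProj T μ x
  have h1 : 0 ≤ ⟪T (eigenProj T μ x), eigenProj T μ x⟫_ℝ := hT.pos.inner_nonneg_left _
  rw [he, real_inner_smul_left, real_inner_self_eq_norm_sq] at h1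
  rcases hμ.lt_or_eq with hμ | hμ
  · have : ‖eigenProj T μ x‖ ^ 2 ≤ 0 := by nlinarith [sq_nonneg ‖eigenProj T μ x‖]
    have := pow_eq_zero_iff (two_ne_zero) |>.1 (le_antisymm this (sq_nonneg _))
    exact norm_eq_zero.1 this
  · exact hT.inj _ (by rw [he, hμ, zero_smul])

/-- Two vectors agree if their components for positive eigenvalues do. -/
theorem ext_pos (hT : IsInjDiag T) {x y : X}
    (h : ∀ μ, 0 < μ → eigenProj T μ x = eigenProj T μ y) : x = y :=
  hT.ext fun μ => by
    rcases le_or_gt μ 0 with hμ | hμ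
    · rw [hT.eigenProj_of_nonpos hμ, hT.eigenProj_of_nonpos hμ]
    · exact h μ hμ

/-- Parseval. It stands in for the bound of `φ(T)` by the supremum of `φ`, without constructing the
operator `φ(T)`. -/
theorem norm_le_of_coeff (hT : IsInjDiag T) {φ : ℝ → ℝ} {c : ℝ} (hc : 0 ≤ c) {x y : X}
    (h : ∀ μ, 0 < μ → eigenProj T μ y = φ μ • eigenProj T μ x)
    (hφ : ∀ μ, 0 < μ → |φ μ| ≤ c) : ‖y‖ ≤ c * ‖x‖ := by
  refine abs_le_of_sq_le_sq' ?_ (by positivity) |>.2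
  rw [mul_pow]
  refine hasSum_le (fun μ => ?_) (hT.hasSum_norm_sq y) ((hT.hasSum_norm_sq x).mul_left (c ^ 2))
  rcases le_or_gt μ 0 with hμ | hμ
  · simp [hT.eigenProj_of_nonpos hμ]
  · rw [h μ hμ, norm_smul, mul_pow]
    gcongr
    exact hφ μ hμ

theorem mem_powDom_of_coeff (hT : IsInjDiag T) {p : ℝ} {x y : X}
    (h : ∀ μ, 0 < μ → eigenProj T μ y = μ ^ p • eigenProj T μ x) :
    x ∈ powDom T p ∧ powApply T p x = y := by
  have h' : (fun μ : ℝ => μ ^ p • eigenProj T μ x) = fun μ => eigenProj T μ y := by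
    funext μ
    rcases le_or_gt μ 0 with hμ | hμ
    · simp [hT.eigenProj_of_nonpos hμ]
    · rw [h μ hμ]
  have hs : HasSum (fun μ : ℝ => μ ^ p • eigenProj T μ x) y := h' ▸ hT.hasSum y
  exact ⟨hs.summable, hs.tsum_eq⟩

theorem eigenProj_powApply (hT : IsInjDiag T) {p : ℝ} {x : X} (hx : x ∈ powDom T p) (μ : ℝ) :
    eigenProj T μ (powApply T p x) = μ ^ p • eigenProj T μ x :=
  eigenProj_hasSum hT.pos (f := fun μ : ℝ => μ ^ p • eigenProj T μ x)
    (fun l => by rw [map_smul, apply_eigenProj, smul_comm])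
    (show Summable fun μ : ℝ => μ ^ p • eigenProj T μ x from hx).hasSum μ

theorem eigenProj_boundedPow (hT : IsInjDiag T) {p : ℝ} (hp : 0 ≤ p) (μ : ℝ) (x : X) :
    eigenProj T μ (boundedPow T p x) = μ ^ p • eigenProj T μ x := by
  have h := boundedPow_spec hT.pos hp x
  rw [h.2, hT.eigenProj_powApply h.1]

theorem boundedPow_add (hT : IsInjDiag T) {p q : ℝ} (hp : 0 ≤ p) (hq : 0 ≤ q) (x : X) :
    boundedPow T p (boundedPow T q x) = boundedPow T (p + q) x :=
  hT.ext_pos fun μ hμ => by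
    rw [hT.eigenProj_boundedPow hp, hT.eigenProj_boundedPow hq,
      hT.eigenProj_boundedPow (add_nonneg hp hq), smul_smul, Real.rpow_add hμ]

theorem boundedPow_one (hT : IsInjDiag T) (x : X) : boundedPow T 1 x = T x :=
  hT.ext_pos fun μ _ => by
    rw [hT.eigenProj_boundedPow zero_le_one, eigenProj_apply hT.pos, Real.rpow_one]

theorem boundedPow_injective (hT : IsInjDiag T) {p : ℝ} (hp : 0 ≤ p) {x y : X}
    (h : boundedPow T p x = boundedPow T p y) : x = y :=
  hT.ext_pos fun μ hμ => by
    have h1 := congrArg (eigenProj T μ) h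
    rw [hT.eigenProj_boundedPow hp, hT.eigenProj_boundedPow hp] at h1
    have hne : μ ^ p ≠ 0 := (Real.rpow_pos_of_pos hμ p).ne'
    exact smul_right_injective X hne h1

/-- A vector of the domain of a negative power lies in the range of the positive one. -/
theorem boundedPow_powApply_neg (hT : IsInjDiag T) {p : ℝ} (hp : 0 ≤ p) {x : X}
    (hx : x ∈ powDom T (-p)) :
    boundedPow T p (powApply T (-p) x) = x :=
  hT.ext_pos fun μ hμ => by
    rw [hT.eigenProj_boundedPow hp, hT.eigenProj_powApply hx, smul_smul, ← Real.rpow_add hμ]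
    simp

/-- The power is symmetric and injective, so nothing nonzero is orthogonal to its range. Douglas'
lemma needs this density. -/
theorem denseRange_boundedPow (hT : IsInjDiag T) {p : ℝ} (hp : 0 ≤ p) :
    DenseRange (boundedPow T p) := by
  have h : (LinearMap.range (boundedPow T p).toLinearMap)ᗮ = ⊥ := by
    rw [Submodule.eq_bot_iff]
    intro x hx
    refine hT.boundedPow_injective hp (y := 0) ?_
    rw [map_zero]
    refine ext_inner_right ℝ fun y => ?_
    rw [inner_boundedPow hT.pos hp, inner_zero_left, real_inner_comm]
    exact hx _ ⟨y, rfl⟩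
  have h2 := Submodule.topologicalClosure_eq_top_iff.2 h
  intro x
  have : x ∈ (LinearMap.range (boundedPow T p).toLinearMap).topologicalClosure := h2 ▸ trivial
  exact this

theorem norm_boundedPow_half_sq (hT : IsInjDiag T) (x : X) :
    ‖boundedPow T (1 / 2) x‖ ^ 2 = ⟪T x, x⟫_ℝ := by
  rw [← real_inner_self_eq_norm_sq, ← inner_boundedPow hT.pos (by norm_num),
    hT.boundedPow_add (by norm_num) (by norm_num)]
  norm_num [hT.boundedPow_one]

end IsInjDiag

end Calculus

/-! ### Trace class operators are compact; countable eigenbases -/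

section Compact

variable {X Y : Type*} [NormedAddCommGroup X] [InnerProductSpace ℝ X] [CompleteSpace X]
  [NormedAddCommGroup Y] [InnerProductSpace ℝ Y] [CompleteSpace Y]

/-- A Hilbert-Schmidt operator is compact. -/
theorem isCompactOperator_of_summable_norm_sq {ι : Type*} (b : HilbertBasis ι ℝ X)
    (T : X →L[ℝ] X) (h : Summable fun i => ‖T (b i)‖ ^ 2) : IsCompactOperator T := by
  classical
  let F : Finset ι → X →L[ℝ] X := fun s => ∑ i ∈ s, (innerSL ℝ (b i)).smulRight (T (b i))
  have hFc : ∀ s, IsCompactOperator (F s) := by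
    intro s
    induction s using Finset.induction_on with
    | empty =>
      have : F ∅ = 0 := by simp [F]
      rw [this]
      exact isCompactOperator_zero
    | insert a s ha ih =>
      have : F (insert a s) = (innerSL ℝ (b a)).smulRight (T (b a)) + F s := by
        simp [F, Finset.sum_insert ha]
      rw [this]
      refine IsCompactOperator.add ?_ ih
      exact (isCompactOperator_of_locallyCompactSpace_dom (innerSL ℝ (b a))).clm_comp
        (ContinuousLinearMap.toSpanSingleton ℝ (T (b a)))
  have hFT : Tendsto F atTop (𝓝 T) := by
    rw [Metric.tendsto_atTop]
    intro ε hε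
    -- Finite-rank truncations converge in norm: Cauchy-Schwarz bounds the remainder by the tail of
    -- the Hilbert-Schmidt sum times `‖x‖`.
    obtain ⟨s, hs⟩ := summable_iff_vanishing_norm.1 h ((ε / 2) ^ 2) (by positivity)
    refine ⟨s, fun s' hs' => ?_⟩
    rw [dist_comm, dist_eq_norm]
    refine lt_of_le_of_lt (ContinuousLinearMap.opNorm_le_bound _ (by positivity) fun x => ?_)
      (half_lt_self hε)
    have h1 : HasSum (fun i => ⟪b i, x⟫_ℝ • T (b i)) (T x) := by
      simpa [b.repr_apply_apply] using (b.hasSum_repr x).mapL T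
    have h2 : Tendsto (fun r : Finset ι => ∑ i ∈ r, ⟪b i, x⟫_ℝ • T (b i) - F s' x) atTop
        (𝓝 (T x - F s' x)) := Tendsto.sub_const h1 _
    refine le_of_tendsto h2.norm ?_
    filter_upwards [eventually_ge_atTop s'] with r hr
    have h3 : ∑ i ∈ r, ⟪b i, x⟫_ℝ • T (b i) - F s' x =
        ∑ i ∈ r \ s', ⟪b i, x⟫_ℝ • T (b i) := by
      rw [← Finset.sum_sdiff hr]
      simp [F]
    rw [h3]
    have h4 : ‖∑ i ∈ r \ s', ⟪b i, x⟫_ℝ • T (b i)‖ ≤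
        ∑ i ∈ r \ s', ‖⟪b i, x⟫_ℝ‖ * ‖T (b i)‖ :=
      (norm_sum_le _ _).trans_eq (Finset.sum_congr rfl fun i _ => norm_smul _ _)
    have h5 := Finset.sum_mul_sq_le_sq_mul_sq (r \ s') (fun i => ‖⟪b i, x⟫_ℝ‖)
      fun i => ‖T (b i)‖
    have h6 : ∑ i ∈ r \ s', ‖⟪b i, x⟫_ℝ‖ ^ 2 ≤ ‖x‖ ^ 2 := b.orthonormal.sum_inner_products_le x
    have h7 := hs (r \ s') (Finset.disjoint_of_subset_right hs' Finset.sdiff_disjoint)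
    have h8 : ∑ i ∈ r \ s', ‖T (b i)‖ ^ 2 ≤ (ε / 2) ^ 2 := (le_abs_self _).trans h7.le
    refine h4.trans (abs_le_of_sq_le_sq' (h5.trans ?_) (by positivity)).2
    rw [mul_pow, mul_comm ((ε / 2) ^ 2)]
    gcongr
  exact isCompactOperator_of_tendsto hFT (Eventually.of_forall hFc)

/-- Positivity tested at `x - c T x`; the `+ 1` in `c = (‖T‖ + 1)⁻¹` only avoids dividing by zero.
Hence a summable diagonal makes `T` Hilbert-Schmidt. -/
theorem norm_sq_apply_le_of_isPositive {T : X →L[ℝ] X} (hT : T.IsPositive) (x : X) :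
    ‖T x‖ ^ 2 ≤ (‖T‖ + 1) * ⟪x, T x⟫_ℝ := by
  set c : ℝ := (‖T‖ + 1)⁻¹ with hc
  have hpos : 0 < ‖T‖ + 1 := by positivity
  have hcp : 0 < c := inv_pos.2 hpos
  have h0 : 0 ≤ ⟪T (x - c • T x), x - c • T x⟫_ℝ := hT.inner_nonneg_left _
  have hs : ⟪T (T x), x⟫_ℝ = ⟪T x, T x⟫_ℝ := hT.isSymmetric _ _
  have hb : ⟪T (T x), T x⟫_ℝ ≤ ‖T‖ * ‖T x‖ ^ 2 := by
    have := real_inner_le_norm (T (T x)) (T x)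
    nlinarith [T.le_opNorm (T x), norm_nonneg (T x)]
  simp only [map_sub, map_smul, inner_sub_left, inner_sub_right, real_inner_smul_left,
    real_inner_smul_right, hs, real_inner_self_eq_norm_sq] at h0
  rw [real_inner_comm]
  have h1 : c * (‖T‖ + 1) = 1 := inv_mul_cancel₀ hpos.ne'
  have h2 : c ^ 2 * ⟪T (T x), T x⟫_ℝ ≤ c ^ 2 * (‖T‖ * ‖T x‖ ^ 2) := by gcongr
  have h3 : c ^ 2 * (‖T‖ * ‖T x‖ ^ 2) ≤ c * ‖T x‖ ^ 2 := by
    have : c ^ 2 * ‖T‖ ≤ c := by nlinarith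
    nlinarith [sq_nonneg ‖T x‖]
  have h4 : c * ‖T x‖ ^ 2 ≤ ⟪T x, x⟫_ℝ := by nlinarith
  calc ‖T x‖ ^ 2 = (‖T‖ + 1) * (c * ‖T x‖ ^ 2) := by rw [← mul_assoc, mul_comm _ c, h1, one_mul]
    _ ≤ _ := by gcongr

/-- A summable diagonal gives compactness, and the spectral theorem then gives totality of the
eigenspaces. -/
theorem IsInjDiag.of_summable {ι : Type*} (b : HilbertBasis ι ℝ X) {T : X →L[ℝ] X}
    (hT : T.IsPositive) (hinj : ∀ x, T x = 0 → x = 0)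
    (h : Summable fun i => ⟪b i, T (b i)⟫_ℝ) : IsInjDiag T := by
  refine ⟨hT, hinj, fun x hx => ?_⟩
  have hc : IsCompactOperator T := isCompactOperator_of_summable_norm_sq b T <|
    Summable.of_nonneg_of_le (fun i => by positivity)
      (fun i => norm_sq_apply_le_of_isPositive hT (b i)) (h.mul_left (‖T‖ + 1))
  have ho := ContinuousLinearMap.orthogonalComplement_iSup_eigenspaces_eq_bot hc hT.isSymmetric
  have hm : x ∈ (⨆ μ, Module.End.eigenspace (T : Module.End ℝ X) μ)ᗮ := by
    rw [← Submodule.iInf_orthogonal, Submodule.mem_iInf]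
    intro μ v hv
    have hv' : T v = μ • v := Module.End.mem_eigenspace_iff.1 hv
    rw [← eigenProj_of_eigenvector hv', inner_eigenProj_comm, hx, inner_zero_right]
  rwa [ho, Submodule.mem_bot] at hm

/-- Orthonormal vectors are `√2` apart, so balls of radius `1 / 2` around them are disjoint.
Countability later allows exchanging sum and expectation. -/
theorem countable_of_orthonormal [TopologicalSpace.SeparableSpace X] {ι : Type*}
    {v : ι → X} (hv : Orthonormal ℝ v) : Countable ι := by
  refine Pairwise.countable_of_isOpen_disjoint (s := fun i => Metric.ball (v i) (1 / 2)) ?_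
    (fun i => Metric.isOpen_ball) fun i => ⟨v i, Metric.mem_ball_self (by norm_num)⟩
  intro i j hij
  refine Metric.ball_disjoint_ball ?_
  have h := norm_sub_sq_real (v i) (v j)
  rw [hv.2 hij, hv.1 i, hv.1 j] at h
  rw [dist_eq_norm]
  nlinarith [norm_nonneg (v i - v j)]

theorem IsInjDiag.exists_eigenbasis {X : Type*} [NormedAddCommGroup X] [InnerProductSpace ℝ X]
    [CompleteSpace X] [TopologicalSpace.SeparableSpace X] {T : X →L[ℝ] X} (hT : IsInjDiag T) :
    ∃ (w : Set X) (_ : Countable w) (b : HilbertBasis w ℝ X) (l : w → ℝ),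
      ∀ i, 0 < l i ∧ T (b i) = l i • b i := by
  choose w b hb using fun μ : ℝ =>
    exists_hilbertBasis ℝ ((T - μ • ContinuousLinearMap.id ℝ X).ker)
  have hon := (orthogonalFamily_ker hT.pos).orthonormal_sigma_orthonormal
    fun μ => (b μ).orthonormal
  simp only [Submodule.coe_subtypeₗᵢ, Submodule.subtype_apply] at hon
  set v : (Σ μ, w μ) → X := fun a => (b a.1 a.2 : X)
  have hbot : (Submodule.span ℝ (Set.range v))ᗮ = ⊥ := by
    rw [Submodule.eq_bot_iff]
    intro x hx
    refine hT.total x fun μ => ?_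
    have : (⟨eigenProj T μ x, eigenProj_mem T μ x⟩ :
        (T - μ • ContinuousLinearMap.id ℝ X).ker) = 0 := by
      refine (b μ).repr.injective (lp.ext (funext fun i => ?_))
      rw [(b μ).repr_apply_apply, map_zero]
      have h1 : ⟪v ⟨μ, i⟩, x⟫_ℝ = 0 := hx _ (Submodule.subset_span ⟨_, rfl⟩)
      have h2 : eigenProj T μ (v ⟨μ, i⟩) = v ⟨μ, i⟩ :=
        eigenProj_of_eigenvector ((mem_ker_iff T μ _).1 (b μ i).2)
      rw [← h2, inner_eigenProj_comm] at h1
      exact h1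
    exact congrArg Subtype.val this
  have hsub : Orthonormal ℝ ((↑) : Set.range v → X) := hon.toSubtypeRange
  have : Countable (Set.range v) := countable_of_orthonormal hsub
  choose a ha using fun i : Set.range v => i.2
  refine ⟨Set.range v, this, HilbertBasis.mkOfOrthogonalEqBot hsub (by simpa using hbot),
    fun i => (a i).1, fun i => ?_⟩
  rw [HilbertBasis.coe_mkOfOrthogonalEqBot]
  have he : T i = (a i).1 • (i : X) := by
    rw [← ha i]
    exact (mem_ker_iff T _ _).1 (b _ (a i).2).2
  refine ⟨?_, he⟩
  by_contra hneg
  have h0 : eigenProj T (a i).1 (i : X) = i := eigenProj_of_eigenvector he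
  rw [hT.eigenProj_of_nonpos (not_lt.1 hneg)] at h0
  have := hsub.1 i
  rw [← h0, norm_zero] at this
  exact zero_ne_one this

end Compact

/-! ### The trace as a sum of eigenvalues -/

section Trace

variable {X Y : Type*} [NormedAddCommGroup X] [InnerProductSpace ℝ X] [CompleteSpace X]
  [NormedAddCommGroup Y] [InnerProductSpace ℝ Y] [CompleteSpace Y]

theorem hasSum_of_tsum_ofReal {ι : Type*} {f : ι → ℝ} (hf : ∀ i, 0 ≤ f i) {c : ℝ} (hc : 0 ≤ c)
    (h : ∑' i, ENNReal.ofReal (f i) = ENNReal.ofReal c) : HasSum f c := by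
  have h1 := ENNReal.hasSum_toReal (f := fun i => ENNReal.ofReal (f i)) (by simp [h])
  rw [← ENNReal.tsum_toReal_eq fun _ => ENNReal.ofReal_ne_top, h, ENNReal.toReal_ofReal hc] at h1
  simpa only [ENNReal.toReal_ofReal (hf _)] using h1

theorem hasSum_inner_sq {ι : Type*} (b : HilbertBasis ι ℝ X) (x : X) :
    HasSum (fun i => ⟪b i, x⟫_ℝ ^ 2) (‖x‖ ^ 2) := by
  have h := b.hasSum_inner_mul_inner x x
  rw [real_inner_self_eq_norm_sq] at h
  convert! h using 2 with i
  rw [sq, real_inner_comm x]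

/-- The trace of a diagonal trace class operator is the sum of the eigenvalues. -/
theorem hasSum_eigenvalues_opTrace {ι : Type*} (b : HilbertBasis ι ℝ X) {R : X →L[ℝ] X}
    (hR : IsPositiveTraceClass R) {r : ι → ℝ} (hr : ∀ i, 0 ≤ r i)
    (hRb : ∀ i, R (b i) = r i • b i) : HasSum r (opTrace R) := by
  have hpos : ∀ x, 0 ≤ ⟪x, R x⟫_ℝ := fun x => hR.1.inner_nonneg_right x
  refine hasSum_of_tsum_ofReal hr (tsum_nonneg fun i => hpos _) ?_
  have h1 : ∀ x, HasSum (fun i => r i * ⟪b i, x⟫_ℝ ^ 2) ⟪x, R x⟫_ℝ := by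
    intro x
    convert! b.hasSum_inner_mul_inner x (R x) using 2 with i
    have : ⟪b i, R x⟫_ℝ = ⟪R (b i), x⟫_ℝ := (hR.1.isSymmetric _ _).symm
    rw [this, hRb, real_inner_smul_left, real_inner_comm]
    ring
  rw [opTrace, ENNReal.ofReal_tsum_of_nonneg (fun i => hpos _) (hR.2 _ _)]
  have h2 : ∀ w, ENNReal.ofReal ⟪someBasis X w, R (someBasis X w)⟫_ℝ =
      ∑' i, ENNReal.ofReal (r i * ⟪b i, someBasis X w⟫_ℝ ^ 2) := by
    intro w
    rw [← (h1 _).tsum_eq, ENNReal.ofReal_tsum_of_nonneg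
      (fun i => mul_nonneg (hr i) (sq_nonneg _)) (h1 _).summable]
  simp_rw [h2]
  -- Tonelli for the double sum of `r i * ⟪b i, e w⟫ ^ 2` over the two bases; Parseval for `b i`
  -- then leaves `r i`.
  rw [ENNReal.tsum_comm]
  refine tsum_congr fun i => ?_
  have h3 := hasSum_inner_sq (someBasis X) (b i)
  rw [b.orthonormal.1 i] at h3
  have h4 := h3.mul_left (r i)
  rw [one_pow, mul_one] at h4
  conv_lhs => rw [← h4.tsum_eq]
  rw [ENNReal.ofReal_tsum_of_nonneg (fun w => mul_nonneg (hr i) (sq_nonneg _)) h4.summable]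
  simp_rw [real_inner_comm]

/-- A bounded power of `T` is `boundedPow T p`, and its trace is the sum of the powers of the
eigenvalues. -/
theorem hasSum_rpow_opTrace {ι : Type*} (b : HilbertBasis ι ℝ X) {T : X →L[ℝ] X}
    (hT : IsInjDiag T) {l : ι → ℝ} (hl : ∀ i, 0 < l i ∧ T (b i) = l i • b i) {p : ℝ}
    (h : IsTraceClassPow T p) : HasSum (fun i => l i ^ p) (opTrace (boundedPow T p)) := by
  obtain ⟨R, hR, hRt⟩ := h
  have hex : ∃ R, IsBoundedPow T p R := ⟨R, hR⟩
  -- The exponent may be negative, so boundedness comes from the trace class hypothesis instead of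
  -- `boundedPow_spec`.
  have hspec : IsBoundedPow T p (boundedPow T p) := by
    rw [boundedPow, dif_pos hex]
    exact hex.choose_spec
  have heq : boundedPow T p = R := by
    ext x
    rw [(hspec x).2, (hR x).2]
  rw [heq]
  refine hasSum_eigenvalues_opTrace b hRt (fun i => Real.rpow_nonneg (hl i).1.le _) fun i => ?_
  rw [(hR _).2]
  refine (hT.mem_powDom_of_coeff fun μ _ => ?_).2
  rw [map_smul]
  by_cases hμ : μ = l i
  · rw [hμ]
  · rw [eigenProj_of_eigenvector_ne hT.pos hμ (hl i).2, smul_zero, smul_zero]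

end Trace

/-! ### The link condition in terms of `B* B` -/

section Link

variable {X Y : Type*} [NormedAddCommGroup X] [InnerProductSpace ℝ X] [CompleteSpace X]
  [NormedAddCommGroup Y] [InnerProductSpace ℝ Y] [CompleteSpace Y]
  {A : X →L[ℝ] Y} {S : X →L[ℝ] X} {C ν : ℝ}

theorem HilbertScaleLink.isInjDiag (h : HilbertScaleLink A S C ν) : IsInjDiag S := by
  refine IsInjDiag.of_summable (someBasis X) h.traceClass.1 (fun x hx => ?_)
    (h.traceClass.2 _ (someBasis X))
  by_contra hne
  have := h.posDef x hne
  rw [hx, inner_zero_left] at this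
  exact lt_irrefl _ this

theorem scaleNorm_eq (hS : S.IsPositive) {r : ℝ} (hr : 0 ≤ r) (x : X) :
    scaleNorm S r x = ‖boundedPow S (r / 2) x‖ := by
  rw [scaleNorm, (boundedPow_spec hS (by positivity) x).2]

theorem inner_opBB (A : X →L[ℝ] Y) (S : X →L[ℝ] X) (x y : X) :
    ⟪opBB A S x, y⟫_ℝ = ⟪opB A S x, opB A S y⟫_ℝ := by
  rw [opBB, ContinuousLinearMap.comp_apply, ContinuousLinearMap.adjoint_inner_left]

theorem opBB_isPositive (A : X →L[ℝ] Y) (S : X →L[ℝ] X) : (opBB A S).IsPositive :=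
  ContinuousLinearMap.isPositive_adjoint_comp_self _

theorem HilbertScaleLink.norm_opB_le (h : HilbertScaleLink A S C ν) (hν : 0 < ν) (x : X) :
    ‖opB A S x‖ ≤ C * ‖boundedPow S ((1 + ν) / 2) x‖ := by
  have := h.upper (boundedPow S (1 / 2) x)
  rw [scaleNorm_eq h.isInjDiag.pos hν.le, h.isInjDiag.boundedPow_add (by positivity) (by norm_num)]
    at this
  rwa [show (1 + ν) / 2 = ν / 2 + 1 / 2 by ring]

theorem HilbertScaleLink.le_norm_opB (h : HilbertScaleLink A S C ν) (hC : 1 < C) (hν : 0 < ν)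
    (x : X) : ‖boundedPow S ((1 + ν) / 2) x‖ ≤ C * ‖opB A S x‖ := by
  have := h.lower (boundedPow S (1 / 2) x)
  rw [scaleNorm_eq h.isInjDiag.pos hν.le, h.isInjDiag.boundedPow_add (by positivity) (by norm_num),
    inv_mul_le_iff₀ (by linarith)] at this
  rwa [show (1 + ν) / 2 = ν / 2 + 1 / 2 by ring]

/-- Injectivity comes from the lower link bound; the diagonal of `B* B` is at most `‖A‖ ^ 2` times
that of `S`. -/
theorem HilbertScaleLink.isInjDiag_opBB (h : HilbertScaleLink A S C ν) (hC : 1 < C) (hν : 0 < ν) :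
    IsInjDiag (opBB A S) := by
  have hS := h.isInjDiag
  refine IsInjDiag.of_summable (someBasis X) (opBB_isPositive A S) (fun x hx => ?_) ?_
  · have h1 := inner_opBB A S x x
    rw [hx, inner_zero_left, real_inner_self_eq_norm_sq] at h1
    have h2 := h.le_norm_opB hC hν x
    rw [pow_eq_zero_iff two_ne_zero |>.1 h1.symm, mul_zero, norm_le_zero_iff] at h2
    exact hS.boundedPow_injective (p := (1 + ν) / 2) (by positivity) (by rw [h2, map_zero])
  · refine Summable.of_nonneg_of_le (fun i => (opBB_isPositive A S).inner_nonneg_right _)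
      (fun i => ?_) ((h.traceClass.2 _ (someBasis X)).mul_left (‖A‖ ^ 2))
    rw [real_inner_comm, inner_opBB, real_inner_self_eq_norm_sq, real_inner_comm,
      ← hS.norm_boundedPow_half_sq, ← mul_pow]
    gcongr
    exact A.le_opNorm _

theorem HilbertScaleLink.norm_opBB_half (h : HilbertScaleLink A S C ν) (hC : 1 < C) (hν : 0 < ν)
    (x : X) : ‖boundedPow (opBB A S) (1 / 2) x‖ = ‖opB A S x‖ := by
  have h1 := (h.isInjDiag_opBB hC hν).norm_boundedPow_half_sq x
  rw [inner_opBB, real_inner_self_eq_norm_sq] at h1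
  exact (sq_eq_sq₀ (norm_nonneg _) (norm_nonneg _)).1 h1

end Link

/-! ### Heinz inequality and Douglas factorization -/

section Heinz

variable {X : Type*} [NormedAddCommGroup X] [InnerProductSpace ℝ X] [CompleteSpace X]

theorem norm_sum_smul_eigenProj_le {T : X →L[ℝ] X} (hT : T.IsPositive) {f : ℝ → ℝ}
    (hf : ∀ μ, |f μ| ≤ 1) (s : Finset ℝ) (x : X) :
    ‖∑ μ ∈ s, f μ • eigenProj T μ x‖ ≤ ‖x‖ := by
  refine abs_le_of_sq_le_sq' ?_ (norm_nonneg _) |>.2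
  have hn := (orthogonalFamily_ker hT).norm_sum
    (fun μ => ⟨f μ • eigenProj T μ x, Submodule.smul_mem _ _ (eigenProj_mem T μ x)⟩) s
  simp only [Submodule.coe_subtypeₗᵢ, Submodule.subtype_apply, Submodule.coe_norm] at hn
  rw [hn]
  refine (Finset.sum_le_sum fun μ _ => ?_).trans (sum_norm_sq_eigenProj_le hT x s)
  rw [norm_smul, mul_pow]
  have : ‖f μ‖ ^ 2 ≤ 1 := pow_le_one₀ (norm_nonneg _) (hf μ)
  nlinarith [sq_nonneg ‖eigenProj T μ x‖]

/-- The exponential form extends to complex exponents; for `l ≤ 0` both sides vanish with the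
projection. -/
theorem IsInjDiag.boundedPow_eigenProj {T : X →L[ℝ] X} (hT : IsInjDiag T) {p : ℝ} (hp : 0 ≤ p)
    (l : ℝ) (x : X) :
    boundedPow T p (eigenProj T l x) = Real.exp (p * Real.log l) • eigenProj T l x := by
  rcases le_or_gt l 0 with hl | hl
  · simp [hT.eigenProj_of_nonpos hl]
  refine hT.ext fun μ => ?_
  rw [hT.eigenProj_boundedPow hp, map_smul]
  by_cases hμ : μ = l
  · rw [hμ, Real.rpow_def_of_pos hl, mul_comm]
  · rw [eigenProj_of_eigenvector_ne hT.pos hμ (apply_eigenProj T l x), smul_zero, smul_zero]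

/-- The double sum is `⟪a, T₁ ^ p b⟫`, with `a` a truncation of `f(T₁) y` and `b` one of `T₂ ^ (-q)
g(T₂) v`. The factors `f`, `g` will be the real and imaginary parts of imaginary powers. -/
theorem IsInjDiag.abs_sum_inner_le {T₁ T₂ : X →L[ℝ] X} (h₁ : IsInjDiag T₁) (h₂ : IsInjDiag T₂)
    {p q C : ℝ} (hp : 0 ≤ p) (hq : 0 ≤ q) (hC : 0 ≤ C)
    (h : ∀ x, ‖boundedPow T₁ p x‖ ≤ C * ‖boundedPow T₂ q x‖) {f g : ℝ → ℝ}
    (hf : ∀ μ, |f μ| ≤ 1) (hg : ∀ μ, |g μ| ≤ 1) (s₁ s₂ : Finset ℝ) (y v : X) :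
    |∑ l ∈ s₁, ∑ μ ∈ s₂, Real.exp (p * Real.log l) * Real.exp (-(q * Real.log μ)) * f l * g μ *
      ⟪eigenProj T₁ l y, eigenProj T₂ μ v⟫_ℝ| ≤ C * (‖y‖ * ‖v‖) := by
  set a : X := ∑ l ∈ s₁, f l • eigenProj T₁ l y
  set b : X := ∑ μ ∈ s₂, (Real.exp (-(q * Real.log μ)) * g μ) • eigenProj T₂ μ v
  have ha : ‖a‖ ≤ ‖y‖ := norm_sum_smul_eigenProj_le h₁.pos hf s₁ y
  have hb : ‖boundedPow T₂ q b‖ ≤ ‖v‖ := by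
    have : boundedPow T₂ q b = ∑ μ ∈ s₂, g μ • eigenProj T₂ μ v := by
      rw [map_sum]
      refine Finset.sum_congr rfl fun μ _ => ?_
      rw [map_smul, h₂.boundedPow_eigenProj hq, smul_smul, mul_right_comm, ← Real.exp_add]
      simp
    rw [this]
    exact norm_sum_smul_eigenProj_le h₂.pos hg s₂ v
  have he : ∑ l ∈ s₁, ∑ μ ∈ s₂, Real.exp (p * Real.log l) * Real.exp (-(q * Real.log μ)) * f l *
      g μ * ⟪eigenProj T₁ l y, eigenProj T₂ μ v⟫_ℝ = ⟪a, boundedPow T₁ p b⟫_ℝ := by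
    rw [← inner_boundedPow h₁.pos hp, map_sum, sum_inner]
    refine Finset.sum_congr rfl fun l _ => ?_
    rw [inner_sum]
    refine Finset.sum_congr rfl fun μ _ => ?_
    rw [map_smul, h₁.boundedPow_eigenProj hp]
    simp only [real_inner_smul_left, real_inner_smul_right]
    ring
  rw [he]
  calc |⟪a, boundedPow T₁ p b⟫_ℝ| ≤ ‖a‖ * ‖boundedPow T₁ p b‖ := abs_real_inner_le_norm _ _
    _ ≤ ‖y‖ * (C * ‖v‖) := by
      gcongr
      exact (h b).trans (by gcongr)
    _ = _ := by ring

/-- An exponential sum with coefficients bounded on the two boundary lines, as in the proof of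
the Heinz inequality. -/
theorem IsInjDiag.norm_sum_cexp_le {T₁ T₂ : X →L[ℝ] X} (h₁ : IsInjDiag T₁) (h₂ : IsInjDiag T₂)
    {p q C : ℝ} (hp : 0 ≤ p) (hq : 0 ≤ q) (hC : 0 ≤ C)
    (h : ∀ x, ‖boundedPow T₁ p x‖ ≤ C * ‖boundedPow T₂ q x‖) (a b : ℝ → ℝ)
    (s₁ s₂ : Finset ℝ) (y v : X) :
    ‖∑ l ∈ s₁, ∑ μ ∈ s₂, Complex.exp (((p * Real.log l - q * Real.log μ : ℝ) : ℂ) +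
      ((a l - b μ : ℝ) : ℂ) * Complex.I) *
      ((⟪eigenProj T₁ l y, eigenProj T₂ μ v⟫_ℝ : ℝ) : ℂ)‖ ≤ 4 * C * (‖y‖ * ‖v‖) := by
  -- The space is real, so `exp (i (a - b))` is split into four products of sines and cosines, each
  -- covered by the real bound. This is the source of the factor `4`.
  have hcos : ∀ c : ℝ → ℝ, ∀ μ, |Real.cos (c μ)| ≤ 1 := fun c μ => Real.abs_cos_le_one _
  have hsin : ∀ c : ℝ → ℝ, ∀ μ, |Real.sin (c μ)| ≤ 1 := fun c μ => Real.abs_sin_le_one _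
  have k1 := h₁.abs_sum_inner_le h₂ hp hq hC h (hcos a) (hcos b) s₁ s₂ y v
  have k2 := h₁.abs_sum_inner_le h₂ hp hq hC h (hsin a) (hsin b) s₁ s₂ y v
  have k3 := h₁.abs_sum_inner_le h₂ hp hq hC h (hsin a) (hcos b) s₁ s₂ y v
  have k4 := h₁.abs_sum_inner_le h₂ hp hq hC h (hcos a) (hsin b) s₁ s₂ y v
  refine (Complex.norm_le_abs_re_add_abs_im _).trans ?_
  simp only [Complex.re_sum, Complex.im_sum,
    Complex.exp_re, Complex.exp_im, Complex.add_re, Complex.add_im, Complex.ofReal_re,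
    Complex.ofReal_im, Complex.mul_re, Complex.mul_im, Complex.I_re, Complex.I_im, mul_zero,
    mul_one, zero_add, add_zero, sub_zero, Real.cos_sub, Real.sin_sub, sub_eq_add_neg (p * _),
    Real.exp_add]
  simp only [mul_add, add_mul, mul_sub, sub_mul, ← mul_assoc, Finset.sum_add_distrib,
    Finset.sum_sub_distrib]
  refine (add_le_add (abs_add_le _ _) (abs_sub _ _)).trans ?_
  linarith

/-- The maximum principle in the strip `0 ≤ re z ≤ 1` for exponential sums. -/
theorem norm_sum_cexp_le_of_boundary {ι : Type*} (s : Finset ι) (c w : ι → ℝ) {M : ℝ}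
    (h0 : ∀ r : ℝ, ‖∑ k ∈ s, Complex.exp ((r : ℂ) * Complex.I * (c k : ℂ)) * (w k : ℂ)‖ ≤ M)
    (h1 : ∀ r : ℝ, ‖∑ k ∈ s, Complex.exp ((1 + (r : ℂ) * Complex.I) * (c k : ℂ)) * (w k : ℂ)‖ ≤ M)
    {θ : ℝ} (hθ : 0 ≤ θ) (hθ' : θ ≤ 1) : |∑ k ∈ s, Real.exp (θ * c k) * w k| ≤ M := by
  let F : ℂ → ℂ := fun z => ∑ k ∈ s, Complex.exp (z * (c k : ℂ)) * (w k : ℂ)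
  have hM : 0 ≤ M := (norm_nonneg _).trans (h0 0)
  have hd : Differentiable ℂ F := by fun_prop
  have hB : BddAbove ((norm ∘ F) '' Complex.HadamardThreeLines.verticalClosedStrip 0 1) := by
    refine ⟨∑ k ∈ s, Real.exp |c k| * |w k|, ?_⟩
    rintro _ ⟨z, hz, rfl⟩
    refine (norm_sum_le _ _).trans (Finset.sum_le_sum fun k _ => ?_)
    rw [norm_mul, Complex.norm_exp, Complex.norm_real, Complex.re_mul_ofReal, Real.norm_eq_abs]
    gcongr
    have hz' : 0 ≤ z.re ∧ z.re ≤ 1 := hz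
    calc z.re * c k ≤ z.re * |c k| := by gcongr; exacts [hz'.1, le_abs_self _]
      _ ≤ 1 * |c k| := by gcongr; exact hz'.2
      _ = |c k| := one_mul _
  have key := Complex.HadamardThreeLines.norm_le_interp_of_mem_verticalClosedStrip₀₁' F
    (z := (θ : ℂ)) (a := M) (b := M) ⟨by simpa using hθ, by simpa using hθ'⟩ hd.diffContOnCl hB
    (fun z hz => by
      have hz' : z.re = 0 := hz
      have : z = (z.im : ℂ) * Complex.I := by
        conv_lhs => rw [← Complex.re_add_im z, hz']
        simp
      rw [this]
      exact h0 z.im)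
    (fun z hz => by
      have hz' : z.re = 1 := hz
      have : z = 1 + (z.im : ℂ) * Complex.I := by
        conv_lhs => rw [← Complex.re_add_im z, hz']
        simp
      rw [this]
      exact h1 z.im)
  rw [← Real.rpow_add_of_nonneg hM (by simpa using hθ') (by simpa using hθ), sub_add_cancel,
    Real.rpow_one] at key
  have hF : F θ = ((∑ k ∈ s, Real.exp (θ * c k) * w k : ℝ) : ℂ) := by
    simp [F]
  rwa [hF, Complex.norm_real, Real.norm_eq_abs] at key

theorem IsInjDiag.boundedPow_zero {T : X →L[ℝ] X} (hT : IsInjDiag T) (x : X) :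
    boundedPow T 0 x = x :=
  hT.ext fun μ => by rw [hT.eigenProj_boundedPow le_rfl, Real.rpow_zero, one_smul]

/-- The Heinz inequality, up to a constant. -/
theorem IsInjDiag.heinz {T₁ T₂ : X →L[ℝ] X} (h₁ : IsInjDiag T₁) (h₂ : IsInjDiag T₂)
    {p q C : ℝ} (hp : 0 ≤ p) (hq : 0 ≤ q) (hC : 1 ≤ C)
    (h : ∀ x, ‖boundedPow T₁ p x‖ ≤ C * ‖boundedPow T₂ q x‖) {θ : ℝ} (hθ : 0 ≤ θ) (hθ' : θ ≤ 1)
    (x : X) : ‖boundedPow T₁ (θ * p) x‖ ≤ 4 * C * ‖boundedPow T₂ (θ * q) x‖ := by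
  have hθp : 0 ≤ θ * p := mul_nonneg hθ hp
  have hθq : 0 ≤ θ * q := mul_nonneg hθ hq
  -- The three lines theorem for `z ↦ ∑ exp (z (p log l - q log μ)) w`, evaluated at `z = θ`. Finite
  -- sums keep it entire and bounded on the strip.
  have hfin : ∀ (y v : X) (s₁ s₂ : Finset ℝ),
      |∑ k ∈ s₁ ×ˢ s₂, Real.exp (θ * (p * Real.log k.1 - q * Real.log k.2)) *
        ⟪eigenProj T₁ k.1 y, eigenProj T₂ k.2 v⟫_ℝ| ≤ 4 * C * (‖y‖ * ‖v‖) := by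
    intro y v s₁ s₂
    refine norm_sum_cexp_le_of_boundary (s₁ ×ˢ s₂)
      (fun k => p * Real.log k.1 - q * Real.log k.2)
      (fun k => ⟪eigenProj T₁ k.1 y, eigenProj T₂ k.2 v⟫_ℝ) (fun r => ?_) (fun r => ?_) hθ hθ'
    -- On `re z = 0` only imaginary powers remain, so the exponents are zero and the hypothesis is
    -- trivial because `1 ≤ C`.
    · have := h₁.norm_sum_cexp_le h₂ (p := 0) (q := 0) le_rfl le_rfl (zero_le_one.trans hC)
        (fun x => by
          rw [h₁.boundedPow_zero, h₂.boundedPow_zero]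
          exact le_mul_of_one_le_left (norm_nonneg _) hC)
        (fun l => r * (p * Real.log l)) (fun μ => r * (q * Real.log μ)) s₁ s₂ y v
      rw [Finset.sum_product]
      convert this using 8
      push_cast
      ring
    · have := h₁.norm_sum_cexp_le h₂ hp hq (zero_le_one.trans hC) h
        (fun l => r * (p * Real.log l)) (fun μ => r * (q * Real.log μ)) s₁ s₂ y v
      rw [Finset.sum_product]
      convert this using 8
      push_cast
      ring
  have hlim : ∀ y : X, ⟪boundedPow T₁ (θ * p) y, x⟫_ℝ ≤
      4 * C * (‖y‖ * ‖boundedPow T₂ (θ * q) x‖) := by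
    intro y
    have hs : ∀ s₁ s₂ : Finset ℝ, ⟪∑ l ∈ s₁, eigenProj T₁ l (boundedPow T₁ (θ * p) y),
        ∑ μ ∈ s₂, eigenProj T₂ μ x⟫_ℝ ≤ 4 * C * (‖y‖ * ‖boundedPow T₂ (θ * q) x‖) := by
      intro s₁ s₂
      refine (le_of_eq ?_).trans
        ((le_abs_self _).trans (hfin y (boundedPow T₂ (θ * q) x) s₁ s₂))
      rw [Finset.sum_product, sum_inner]
      refine Finset.sum_congr rfl fun l _ => ?_
      rw [inner_sum]
      refine Finset.sum_congr rfl fun μ _ => ?_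
      rcases le_or_gt l 0 with hl | hl
      · simp [h₁.eigenProj_of_nonpos hl]
      rcases le_or_gt μ 0 with hμ | hμ
      · simp [h₂.eigenProj_of_nonpos hμ]
      rw [h₁.eigenProj_boundedPow hθp, h₂.eigenProj_boundedPow hθq, real_inner_smul_left,
        real_inner_smul_right, Real.rpow_def_of_pos hl, Real.rpow_def_of_pos hμ, ← mul_assoc
        (Real.exp (θ * _)), ← Real.exp_add]
      congr 2
      ring
    refine le_of_tendsto (Tendsto.inner (h₁.hasSum (boundedPow T₁ (θ * p) y))
      tendsto_const_nhds) (Eventually.of_forall fun s₁ => ?_)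
    exact le_of_tendsto (Tendsto.inner tendsto_const_nhds (h₂.hasSum x))
      (Eventually.of_forall fun s₂ => hs s₁ s₂)
  -- Testing with `y = T₁ ^ (θ p) x` gives the squared norm on the left; one factor is then
  -- cancelled.
  have h3 := hlim (boundedPow T₁ (θ * p) x)
  rw [inner_boundedPow h₁.pos hθp, real_inner_self_eq_norm_sq] at h3
  rcases (norm_nonneg (boundedPow T₁ (θ * p) x)).eq_or_lt with h0 | h0
  · rw [← h0]
    positivity
  · refine le_of_mul_le_mul_left ?_ h0
    linarith

/-- Douglas' factorization lemma for symmetric operators. -/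
theorem exists_factorization {P Q : X →L[ℝ] X} (hP : ∀ x y, ⟪P x, y⟫_ℝ = ⟪x, P y⟫_ℝ)
    (hQ : ∀ x y, ⟪Q x, y⟫_ℝ = ⟪x, Q y⟫_ℝ) (hd : DenseRange Q) {c : ℝ} (hc : 0 ≤ c)
    (h : ∀ x, ‖P x‖ ≤ c * ‖Q x‖) :
    ∃ E : X →L[ℝ] X, (∀ x, P x = Q (E x)) ∧ ∀ x, ‖E x‖ ≤ c * ‖x‖ := by
  -- `D` extends `Q x ↦ P x` from the dense range of `Q`. From `D Q = P` and symmetry, `P = Q D*`.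
  let D : X →L[ℝ] X := P.toLinearMap.extendOfNorm Q.toLinearMap
  have hD : ∀ x, D (Q x) = P x := LinearMap.extendOfNorm_eq hd ⟨c, h⟩
  have hDn : ‖D‖ ≤ c := ContinuousLinearMap.opNorm_le_bound _ hc fun x =>
    LinearMap.norm_extendOfNorm_apply_le hd c h x
  refine ⟨ContinuousLinearMap.adjoint D, fun x => ext_inner_right ℝ fun y => ?_, fun x => ?_⟩
  · rw [hQ, ContinuousLinearMap.adjoint_inner_left, hD, hP]
  · refine ((ContinuousLinearMap.adjoint D).le_opNorm x).trans ?_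
    rw [LinearIsometryEquiv.norm_map]
    gcongr

end Heinz

/-! ### Exchanging powers of `S` and of `B* B` -/

section Link

variable {X Y : Type*} [NormedAddCommGroup X] [InnerProductSpace ℝ X] [CompleteSpace X]
  [NormedAddCommGroup Y] [InnerProductSpace ℝ Y] [CompleteSpace Y]
  {A : X →L[ℝ] Y} {S : X →L[ℝ] X} {C ν : ℝ}

/-- `S ^ r = (B* B) ^ (r / (1 + ν)) E` with a bounded operator `E`, for `0 ≤ 2 r ≤ 1 + ν`. -/
theorem HilbertScaleLink.exists_factor (h : HilbertScaleLink A S C ν) (hC : 1 < C) (hν : 0 < ν)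
    {r : ℝ} (hr : 0 ≤ r) (hr' : r ≤ (1 + ν) / 2) :
    ∃ E : X →L[ℝ] X, (∀ x, boundedPow S r x = boundedPow (opBB A S) (r / (1 + ν)) (E x)) ∧
      ∀ x, ‖E x‖ ≤ 4 * C * ‖x‖ := by
  have hS := h.isInjDiag
  have hH := h.isInjDiag_opBB hC hν
  have hk : 0 ≤ r / (1 + ν) := by positivity
  refine exists_factorization (inner_boundedPow hS.pos hr) (inner_boundedPow hH.pos hk)
    (hH.denseRange_boundedPow hk) (by linarith) fun x => ?_
  have := hS.heinz hH (p := (1 + ν) / 2) (q := 1 / 2) (by positivity) (by norm_num) hC.le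
    (fun x => by rw [h.norm_opBB_half hC hν]; exact h.le_norm_opB hC hν x)
    (θ := 2 * r / (1 + ν)) (by positivity) (by rw [div_le_one (by positivity)]; linarith) x
  rwa [show 2 * r / (1 + ν) * ((1 + ν) / 2) = r by field_simp,
    show 2 * r / (1 + ν) * (1 / 2) = r / (1 + ν) by field_simp] at this

/-- `(B* B) ^ (r / (1 + ν)) = S ^ r D` with a bounded operator `D`, for `0 ≤ 2 r ≤ 1 + ν`. -/
theorem HilbertScaleLink.exists_factor_opBB (h : HilbertScaleLink A S C ν) (hC : 1 < C)
    (hν : 0 < ν) {r : ℝ} (hr : 0 ≤ r) (hr' : r ≤ (1 + ν) / 2) :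
    ∃ D : X →L[ℝ] X, ∀ x, boundedPow (opBB A S) (r / (1 + ν)) x = boundedPow S r (D x) := by
  have hS := h.isInjDiag
  have hH := h.isInjDiag_opBB hC hν
  have hk : 0 ≤ r / (1 + ν) := by positivity
  obtain ⟨D, hD, -⟩ := exists_factorization (inner_boundedPow hH.pos hk)
    (inner_boundedPow hS.pos hr) (hS.denseRange_boundedPow hr) (c := 4 * C) (by linarith)
    fun x => by
      have := hH.heinz hS (p := 1 / 2) (q := (1 + ν) / 2) (by norm_num) (by positivity) hC.le
        (fun x => by rw [h.norm_opBB_half hC hν]; exact h.norm_opB_le hν x)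
        (θ := 2 * r / (1 + ν)) (by positivity) (by rw [div_le_one (by positivity)]; linarith) x
      rwa [show 2 * r / (1 + ν) * ((1 + ν) / 2) = r by field_simp,
        show 2 * r / (1 + ν) * (1 / 2) = r / (1 + ν) by field_simp] at this
  exact ⟨D, hD⟩

end Link

/-! ### Existence and uniqueness of `z₀` -/

section SourceElement

variable {X Y : Type*} [NormedAddCommGroup X] [InnerProductSpace ℝ X] [CompleteSpace X]
  [NormedAddCommGroup Y] [InnerProductSpace ℝ Y] [CompleteSpace Y]
  {A : X →L[ℝ] Y} {S : X →L[ℝ] X} {C ν : ℝ}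

/-- Since `S ^ (s/2) = S ^ (1/2) (B* B) ^ ρ E`, the solution is `E S ^ (-s/2) v`. The bound `s ≤ ν +
2` is exactly what allows factoring `S ^ ((s - 1) / 2)`. -/
theorem HilbertScaleLink.existsUnique_solvesAux_of_one_le (h : HilbertScaleLink A S C ν)
    (hC : 1 < C) (hν : 0 < ν) {s : ℝ} (hs : 1 ≤ s) (hs' : s ≤ ν + 2) {v : X}
    (hv : v ∈ powDom S (-(s / 2))) : ∃! z, SolvesAux A S ν s v z := by
  have hS := h.isInjDiag
  have hH := h.isInjDiag_opBB hC hν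
  have hρ : 0 ≤ (s - 1) / (2 * (1 + ν)) := div_nonneg (by linarith) (by positivity)
  obtain ⟨E, hE, -⟩ := h.exists_factor hC hν (r := (s - 1) / 2) (by linarith) (by linarith)
  rw [div_div] at hE
  simp only [solvesAux_iff A hS.pos hν hs, ← (boundedPow_spec hH.pos hρ _).2]
  refine ⟨E (powApply S (-(s / 2)) v), ?_, fun z hz => ?_⟩
  · simp only
    rw [← hE, hS.boundedPow_add (by norm_num) (by linarith),
      show 1 / 2 + (s - 1) / 2 = s / 2 by ring, hS.boundedPow_powApply_neg (by linarith) hv]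
  · simp only at hz
    refine hH.boundedPow_injective hρ ?_
    refine hS.boundedPow_injective (p := 1 / 2) (by norm_num) ?_
    rw [← hz, ← hE, hS.boundedPow_add (by norm_num) (by linarith),
      show 1 / 2 + (s - 1) / 2 = s / 2 by ring, hS.boundedPow_powApply_neg (by linarith) hv]

/-- Here `S ^ ((1 - s) / 2)` and the corresponding power of `B* B` have equal range, so `E` and `D`
are mutually inverse. The negative power of `B* B` at `S ^ (1/2) ψ` is `E S ^ (s/2) ψ`, which makes
the weak equation `E* z = S ^ (-s/2) v`. -/
theorem HilbertScaleLink.existsUnique_solvesAux_of_lt_one (h : HilbertScaleLink A S C ν)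
    (hC : 1 < C) (hν : 0 < ν) {s : ℝ} (hs : 0 ≤ s) (hs' : s < 1) {v : X}
    (hv : v ∈ powDom S (-(s / 2))) : ∃! z, SolvesAux A S ν s v z := by
  have hS := h.isInjDiag
  have hH := h.isInjDiag_opBB hC hν
  have hr : 0 ≤ (1 - s) / 2 := by linarith
  have hk : 0 ≤ (1 - s) / 2 / (1 + ν) := by positivity
  obtain ⟨E, hE, -⟩ := h.exists_factor hC hν hr (by linarith)
  obtain ⟨D, hD⟩ := h.exists_factor_opBB hC hν hr (by linarith)
  have hDE : ∀ x, D (E x) = x := fun x => hS.boundedPow_injective hr (by rw [← hD, ← hE])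
  have hED : ∀ x, E (D x) = x := fun x => hH.boundedPow_injective hk (by rw [← hE, ← hD])
  have hpow : ∀ ψ, boundedPow S (1 / 2) ψ ∈ powDom (opBB A S) ((s - 1) / (2 * (1 + ν))) ∧
      powApply (opBB A S) ((s - 1) / (2 * (1 + ν))) (boundedPow S (1 / 2) ψ) =
        E (boundedPow S (s / 2) ψ) := by
    intro ψ
    refine hH.mem_powDom_of_coeff fun μ hμ => ?_
    have : boundedPow S (1 / 2) ψ =
        boundedPow (opBB A S) ((1 - s) / 2 / (1 + ν)) (E (boundedPow S (s / 2) ψ)) := by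
      rw [← hE, hS.boundedPow_add hr (by linarith)]
      ring_nf
    rw [this, hH.eigenProj_boundedPow hk, smul_smul, ← Real.rpow_add hμ,
      show (s - 1) / (2 * (1 + ν)) + (1 - s) / 2 / (1 + ν) = 0 by field_simp; ring,
      Real.rpow_zero, one_smul]
  have hiff : ∀ z, SolvesAux A S ν s v z ↔
      ∀ ψ, ⟪v, ψ⟫_ℝ = ⟪z, E (boundedPow S (s / 2) ψ)⟫_ℝ := fun z =>
    forall_congr' fun ψ => by rw [(hpow ψ).2, and_iff_right (hpow ψ).1]
  simp only [hiff]
  refine ⟨ContinuousLinearMap.adjoint D (powApply S (-(s / 2)) v), fun ψ => ?_, fun z hz => ?_⟩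
  · rw [ContinuousLinearMap.adjoint_inner_left, hDE, ← inner_boundedPow hS.pos (by linarith),
      hS.boundedPow_powApply_neg (by linarith) hv]
  · have hEz : ContinuousLinearMap.adjoint E z = powApply S (-(s / 2)) v := by
      refine hS.boundedPow_injective (p := s / 2) (by linarith) ?_
      rw [hS.boundedPow_powApply_neg (by linarith) hv]
      refine ext_inner_right ℝ fun ψ => ?_
      rw [inner_boundedPow hS.pos (by linarith), ContinuousLinearMap.adjoint_inner_left, hz ψ]
    rw [← hEz]
    refine ext_inner_right ℝ fun x => ?_
    rw [ContinuousLinearMap.adjoint_inner_left, ContinuousLinearMap.adjoint_inner_left, hED]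

theorem HilbertScaleLink.existsUnique_solvesAux (h : HilbertScaleLink A S C ν)
    (hC : 1 < C) (hν : 0 < ν) {s : ℝ} (hs : 0 ≤ s) (hs' : s ≤ ν + 2) {v : X}
    (hv : v ∈ powDom S (-(s / 2))) : ∃! z, SolvesAux A S ν s v z := by
  rcases le_or_gt 1 s with h1 | h1
  · exact h.existsUnique_solvesAux_of_one_le hC hν h1 hs' hv
  · exact h.existsUnique_solvesAux_of_lt_one hC hν hs h1 hv

end SourceElement

/-! ### The gain operator and its spectral representation -/

section Gain

variable {X Y : Type*} [NormedAddCommGroup X] [InnerProductSpace ℝ X] [CompleteSpace X]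
  [NormedAddCommGroup Y] [InnerProductSpace ℝ Y] [CompleteSpace Y]
  {A : X →L[ℝ] Y} {S : X →L[ℝ] X} {C ν α : ℝ}

/-- Lax-Milgram: the form of `H + α` is coercive with constant `α`. -/
theorem exists_resolvent {H : X →L[ℝ] X} (hH : H.IsPositive) (hα : 0 < α) :
    ∃ R : X →L[ℝ] X, (∀ x, H (R x) + α • R x = x) ∧ ∀ x, R (H x + α • x) = x := by
  let T : X →L[ℝ] X := H + α • ContinuousLinearMap.id ℝ X
  let B : X →L[ℝ] X →L[ℝ] ℝ := innerSL ℝ ∘L T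
  have hB : ∀ v w, B v w = ⟪H v + α • v, w⟫_ℝ := fun v w => rfl
  have hc : IsCoercive B := ⟨α, hα, fun u => by
    rw [hB, inner_add_left, real_inner_smul_left, real_inner_self_eq_norm_sq]
    nlinarith [hH.inner_nonneg_left u]⟩
  have he : ∀ v, hc.continuousLinearEquivOfBilin v = H v + α • v := fun v =>
    ext_inner_right ℝ fun w => by rw [hc.continuousLinearEquivOfBilin_apply, hB]
  refine ⟨hc.continuousLinearEquivOfBilin.symm, fun x => ?_, fun x => ?_⟩
  · rw [← he]
    simp
  · rw [← he]
    simp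

theorem adjoint_opB_apply (hS : S.IsPositive) (y : Y) :
    ContinuousLinearMap.adjoint (opB A S) y =
      boundedPow S (1 / 2) (ContinuousLinearMap.adjoint A y) := by
  refine ext_inner_right ℝ fun x => ?_
  rw [ContinuousLinearMap.adjoint_inner_left, inner_boundedPow hS (by norm_num),
    ContinuousLinearMap.adjoint_inner_left]
  rfl

/-- The gain operator equals `S ^ (1/2) (B* B + α)⁻¹ B*`. -/
theorem IsInjDiag.isGain_iff (hS : IsInjDiag S) (hα : 0 < α) {R : X →L[ℝ] X}
    (hR : ∀ x, opBB A S (R x) + α • R x = x) (hR' : ∀ x, R (opBB A S x + α • x) = x)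
    {G : Y →L[ℝ] X} :
    IsGain A S α G ↔
      ∀ y, G y = boundedPow S (1 / 2) (R (ContinuousLinearMap.adjoint (opB A S) y)) := by
  have hhalf : ∀ x, boundedPow S (1 / 2) (boundedPow S (1 / 2) x) = S x := fun x => by
    rw [hS.boundedPow_add (by norm_num) (by norm_num)]
    norm_num [hS.boundedPow_one]
  have hBB : ∀ w, opBB A S w = boundedPow S (1 / 2)
      (ContinuousLinearMap.adjoint A (A (boundedPow S (1 / 2) w))) := fun w => by
    rw [opBB, ContinuousLinearMap.comp_apply, adjoint_opB_apply hS.pos]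
    rfl
  constructor
  · intro hG y
    obtain ⟨hdom, heq⟩ := hG y
    set g := powApply S (-1) (G y)
    have hx : boundedPow S (1 / 2) (boundedPow S (1 / 2) g) = G y := by
      rw [hhalf, ← hS.boundedPow_one, hS.boundedPow_powApply_neg zero_le_one hdom]
    have hw : opBB A S (boundedPow S (1 / 2) g) + α • boundedPow S (1 / 2) g =
        ContinuousLinearMap.adjoint (opB A S) y := by
      rw [hBB, hx, adjoint_opB_apply hS.pos, ← heq, map_add, map_smul]
    rw [← hw, hR', hx]
  · intro hG y
    set w := R (ContinuousLinearMap.adjoint (opB A S) y) with hw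
    have hGw : G y = boundedPow S (1 / 2) w := hG y
    set g := α⁻¹ • (ContinuousLinearMap.adjoint A y - ContinuousLinearMap.adjoint A (A (G y)))
      with hg
    have hwg : boundedPow S (1 / 2) g = w := by
      have h1 := hR (ContinuousLinearMap.adjoint (opB A S) y)
      rw [← hw, hBB, ← hGw, adjoint_opB_apply hS.pos] at h1
      rw [hg, map_smul, map_sub, ← h1, add_sub_cancel_left, smul_smul, inv_mul_cancel₀ hα.ne',
        one_smul]
    have hSg : S g = G y := by rw [← hhalf, hwg, hGw]
    have hp := hS.mem_powDom_of_coeff (p := -1) (x := G y) (y := g) fun μ hμ => by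
      rw [← hSg, eigenProj_apply hS.pos, smul_smul, Real.rpow_neg_one, inv_mul_cancel₀ hμ.ne',
        one_smul]
    refine ⟨hp.1, ?_⟩
    rw [hp.2, hg, smul_smul, mul_inv_cancel₀ hα.ne', one_smul]
    abel

theorem IsInjDiag.existsUnique_isGain (hS : IsInjDiag S) (hα : 0 < α) :
    ∃! G, IsGain A S α G := by
  obtain ⟨R, hR, hR'⟩ := exists_resolvent (opBB_isPositive A S) hα
  refine ⟨boundedPow S (1 / 2) ∘L R ∘L ContinuousLinearMap.adjoint (opB A S),
    (hS.isGain_iff hα hR hR').2 fun y => rfl, fun G hG => ?_⟩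
  ext y
  exact (hS.isGain_iff hα hR hR').1 hG y

/-- The adjoint of the transition operator `I - G A`. -/
noncomputable def transAdj (A : X →L[ℝ] Y) (G : Y →L[ℝ] X) : X →L[ℝ] X :=
  ContinuousLinearMap.id ℝ X - ContinuousLinearMap.adjoint A ∘L ContinuousLinearMap.adjoint G

theorem inner_transAdj (A : X →L[ℝ] Y) (G : Y →L[ℝ] X) (x u : X) :
    ⟪transAdj A G x, u⟫_ℝ = ⟪x, u - G (A u)⟫_ℝ := by
  simp [transAdj, inner_sub_left, inner_sub_right, ContinuousLinearMap.adjoint_inner_left]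

/-- Spectral data of a gain operator: the adjoint is `B R S ^ (1/2)`, where `R` acts on the
eigenspaces of `B* B` as multiplication by `1 / (μ + α)`. -/
theorem HilbertScaleLink.exists_gain_repr (h : HilbertScaleLink A S C ν) (hC : 1 < C) (hν : 0 < ν)
    (hα : 0 < α) {G : Y →L[ℝ] X} (hG : IsGain A S α G) :
    ∃ R : X →L[ℝ] X,
      (∀ μ, 0 < μ → ∀ x, eigenProj (opBB A S) μ (R x) = (μ + α)⁻¹ • eigenProj (opBB A S) μ x) ∧
      (∀ x, ContinuousLinearMap.adjoint G x = opB A S (R (boundedPow S (1 / 2) x))) ∧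
      ∀ x, boundedPow S (1 / 2) (transAdj A G x) = α • R (boundedPow S (1 / 2) x) := by
  have hS := h.isInjDiag
  have hH := h.isInjDiag_opBB hC hν
  obtain ⟨R, hR, hR'⟩ := exists_resolvent (opBB_isPositive A S) hα
  have hG' := (hS.isGain_iff hα hR hR').1 hG
  have hsymm : ∀ x y, ⟪R x, y⟫_ℝ = ⟪x, R y⟫_ℝ := by
    intro x y
    have h1 : ⟪opBB A S (R x), R y⟫_ℝ = ⟪R x, opBB A S (R y)⟫_ℝ := hH.pos.isSymmetric _ _
    conv_lhs => rw [← hR y]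
    conv_rhs => rw [← hR x]
    rw [inner_add_left, inner_add_right, h1, real_inner_smul_left, real_inner_smul_right]
  have hadj : ∀ x, ContinuousLinearMap.adjoint G x = opB A S (R (boundedPow S (1 / 2) x)) := by
    intro x
    refine ext_inner_right ℝ fun y => ?_
    rw [ContinuousLinearMap.adjoint_inner_left, hG', ← inner_boundedPow hS.pos (by norm_num),
      ← hsymm, ContinuousLinearMap.adjoint_inner_right]
  refine ⟨R, fun μ hμ x => ?_, hadj, fun x => ?_⟩
  · have h1 := congrArg (eigenProj (opBB A S) μ) (hR x)
    rw [map_add, eigenProj_apply hH.pos, map_smul, ← add_smul] at h1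
    rw [← h1, smul_smul, inv_mul_cancel₀ (by positivity), one_smul]
  · have h1 := hR (boundedPow S (1 / 2) x)
    rw [transAdj, sub_apply, ContinuousLinearMap.comp_apply, map_sub,
      ← adjoint_opB_apply hS.pos, hadj, ContinuousLinearMap.id_apply]
    rw [opBB, ContinuousLinearMap.comp_apply] at h1
    nth_rewrite 1 [← h1]
    rw [add_sub_cancel_left]

/-- Iterates the intertwining relation: `S ^ (1/2)` carries the adjoint transition operator to `α
(B* B + α)⁻¹`. -/
theorem HilbertScaleLink.eigenProj_transAdj_pow (h : HilbertScaleLink A S C ν) (hC : 1 < C)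
    (hν : 0 < ν) (hα : 0 < α) {G : Y →L[ℝ] X} (hG : IsGain A S α G) {μ : ℝ} (hμ : 0 < μ)
    (k : ℕ) (x : X) :
    eigenProj (opBB A S) μ (boundedPow S (1 / 2) ((transAdj A G ^ k) x)) =
      (α / (μ + α)) ^ k • eigenProj (opBB A S) μ (boundedPow S (1 / 2) x) := by
  obtain ⟨R, hR, -, hL⟩ := h.exists_gain_repr hC hν hα hG
  induction k generalizing x with
  | zero => simp
  | succ k ih =>
    rw [pow_succ, mul_apply_eq_comp, ih, hL, map_smul, hR μ hμ, smul_smul, smul_smul,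
      pow_succ, mul_assoc, ← div_eq_mul_inv]

end Gain

/-! ### Scalar filter estimates -/

section Scalar

theorem sum_Icc_pow_mul_one_sub (q : ℝ) (n : ℕ) :
    (∑ k ∈ Finset.Icc 1 n, q ^ k) * (1 - q) = q - q ^ (n + 1) := by
  induction n with
  | zero => simp
  | succ n ih =>
    rw [Finset.sum_Icc_succ_top (by omega), add_mul, ih]
    ring

/-- Interpolation between two bounds. -/
theorem le_rpow_mul_rpow {m a b θ : ℝ} (hm : 0 ≤ m) (ha : m ≤ a) (hb : m ≤ b) (hθ : 0 ≤ θ)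
    (hθ' : θ ≤ 1) : m ≤ a ^ θ * b ^ (1 - θ) := by
  have h1 : 0 ≤ 1 - θ := by linarith
  calc m = m ^ θ * m ^ (1 - θ) := by
        rw [← Real.rpow_add_of_nonneg hm hθ h1, add_sub_cancel, Real.rpow_one]
    _ ≤ a ^ θ * b ^ (1 - θ) := by
        have := hm.trans ha
        gcongr

/-- The mean is at most `1`, and at most `α / (n μ)` because the geometric series started at `k = 1`
sums to `q / (1 - q) = α / μ`. The second bound is taken with weight `κ`. -/
theorem bias_scalar_le {μ α κ : ℝ} {n : ℕ} (hμ : 0 < μ) (hα : 0 < α) (hn : 1 ≤ n) (hκ : 0 ≤ κ)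
    (hκ' : κ ≤ 1) :
    |μ ^ κ * ((n : ℝ)⁻¹ * ∑ k ∈ Finset.Icc 1 n, (α / (μ + α)) ^ k)| ≤ ((n : ℝ) / α) ^ (-κ) := by
  have hn0 : (0 : ℝ) < n := by exact_mod_cast hn
  set q := α / (μ + α) with hq
  have hq0 : 0 < q := by positivity
  have hq1 : q ≤ 1 := by rw [hq, div_le_one (by positivity)]; linarith
  set σ := ∑ k ∈ Finset.Icc 1 n, q ^ k with hσ
  have h0 : 0 ≤ σ := Finset.sum_nonneg fun k _ => by positivity
  have h1 : σ ≤ n := by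
    calc σ ≤ ∑ k ∈ Finset.Icc 1 n, (1 : ℝ) :=
          Finset.sum_le_sum fun k _ => pow_le_one₀ hq0.le hq1
      _ = n := by simp
  have h2 : σ ≤ α / μ := by
    have h3 := sum_Icc_pow_mul_one_sub q n
    have h4 : 1 - q = μ / (μ + α) := by rw [hq]; field_simp; ring
    have h5 : q = α / μ * (1 - q) := by rw [h4, hq]; field_simp
    have h6 : 0 < 1 - q := by rw [h4]; positivity
    refine le_of_mul_le_mul_right ?_ h6
    rw [h3, ← h5]
    linarith [pow_pos hq0 (n + 1)]
  rw [abs_of_nonneg (by positivity)]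
  have h3 : (n : ℝ)⁻¹ * σ ≤ 1 := by rw [inv_mul_le_iff₀ hn0]; linarith
  have h4 : (n : ℝ)⁻¹ * σ ≤ α / (n * μ) := by
    rw [inv_mul_le_iff₀ hn0]
    refine h2.trans_eq ?_
    field_simp
  have h5 := le_rpow_mul_rpow (by positivity) h4 h3 hκ hκ'
  rw [Real.one_rpow, mul_one] at h5
  calc μ ^ κ * ((n : ℝ)⁻¹ * σ) ≤ μ ^ κ * (α / (n * μ)) ^ κ := by gcongr
    _ = (α / n) ^ κ := by
      rw [← Real.mul_rpow hμ.le (by positivity)]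
      congr 1
      field_simp
    _ = ((n : ℝ) / α) ^ (-κ) := by
      rw [Real.rpow_neg (by positivity), ← Real.inv_rpow (by positivity), inv_div]

/-- Interpolates the bounds `1 / μ` and `n / α` with weights `(1 + τ) / 2` and `(1 - τ) / 2`. -/
theorem variance_scalar_le {μ α τ : ℝ} {m n : ℕ} (hμ : 0 < μ) (hα : 0 < α) (hn : 1 ≤ n)
    (hm : m ≤ n) (hτ : 0 ≤ τ) (hτ' : τ ≤ 1) :
    |μ ^ ((1 + τ) / 2) * ((μ + α)⁻¹ * ∑ k ∈ Finset.range m, (α / (μ + α)) ^ k)| ≤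
      ((n : ℝ) / α) ^ ((1 - τ) / 2) := by
  have hn0 : (0 : ℝ) < n := by exact_mod_cast hn
  set q := α / (μ + α) with hq
  have hq0 : 0 < q := by positivity
  have hq1 : q ≤ 1 := by rw [hq, div_le_one (by positivity)]; linarith
  set σ := ∑ k ∈ Finset.range m, q ^ k with hσ
  have h0 : 0 ≤ σ := Finset.sum_nonneg fun k _ => by positivity
  have h1 : σ ≤ n := by
    calc σ ≤ ∑ k ∈ Finset.range m, (1 : ℝ) :=
          Finset.sum_le_sum fun k _ => pow_le_one₀ hq0.le hq1
      _ = m := by simp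
      _ ≤ n := by exact_mod_cast hm
  have h2 : (μ + α)⁻¹ * σ ≤ μ⁻¹ := by
    have h3 : σ * (1 - q) = 1 - q ^ m := geom_sum_mul_neg q m
    have h4 : 1 - q = μ / (μ + α) := by rw [hq]; field_simp; ring
    rw [h4] at h3
    have h5 : (μ + α)⁻¹ * σ = μ⁻¹ * (1 - q ^ m) := by rw [← h3]; field_simp
    rw [h5]
    refine mul_le_of_le_one_right (by positivity) ?_
    linarith [pow_pos hq0 m]
  have h3 : (μ + α)⁻¹ * σ ≤ n / α := by
    rw [div_eq_inv_mul]
    gcongr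
    linarith
  rw [abs_of_nonneg (by positivity)]
  have h5 := le_rpow_mul_rpow (by positivity) h2 h3 (θ := (1 + τ) / 2) (by linarith) (by linarith)
  calc μ ^ ((1 + τ) / 2) * ((μ + α)⁻¹ * σ)
      ≤ μ ^ ((1 + τ) / 2) * (μ⁻¹ ^ ((1 + τ) / 2) * (n / α) ^ (1 - (1 + τ) / 2)) := by gcongr
    _ = ((n : ℝ) / α) ^ ((1 - τ) / 2) := by
      rw [← mul_assoc, ← Real.mul_rpow hμ.le (by positivity), mul_inv_cancel₀ hμ.ne',
        Real.one_rpow, one_mul]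
      congr 1
      ring

end Scalar

/-! ### Operator bounds for bias and variance -/

section Deterministic

variable {X Y : Type*} [NormedAddCommGroup X] [InnerProductSpace ℝ X] [CompleteSpace X]
  [NormedAddCommGroup Y] [InnerProductSpace ℝ Y] [CompleteSpace Y]
  {A : X →L[ℝ] Y} {S : X →L[ℝ] X} {C ν α s t τ : ℝ}

/-- The average of the adjoint transition powers. -/
noncomputable def avgTransAdj (A : X →L[ℝ] Y) (G : Y →L[ℝ] X) (n : ℕ) : X →L[ℝ] X :=
  (n : ℝ)⁻¹ • ∑ k ∈ Finset.Icc 1 n, transAdj A G ^ k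

/-- The bias of the averaged iterate. -/
theorem HilbertScaleLink.bias_le (h : HilbertScaleLink A S C ν) (hC : 1 < C) (hν : 0 < ν)
    (hα : 0 < α) (hs : 0 ≤ s) (hs' : s ≤ ν + 2) (ht : 0 ≤ t) (ht' : t ≤ ν) {G : Y →L[ℝ] X}
    (hG : IsGain A S α G) {v z : X} (hz : SolvesAux A S ν s v z) {n : ℕ} (hn : 1 ≤ n) :
    ‖boundedPow S (t / 2) (ContinuousLinearMap.adjoint (avgTransAdj A G n) v)‖ ≤
      4 * C * ((n : ℝ) / α) ^ (-((s + t) / (2 * (1 + ν)))) * ‖z‖ := by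
  have hS := h.isInjDiag
  have hH := h.isInjDiag_opBB hC hν
  have hn0 : (0 : ℝ) < n := by exact_mod_cast hn
  have hκ : 0 ≤ (1 + t) / 2 / (1 + ν) := by positivity
  obtain ⟨E, hE, hEn⟩ := h.exists_factor hC hν (r := (1 + t) / 2) (by positivity) (by linarith)
  set a := ((n : ℝ) / α) ^ (-((s + t) / (2 * (1 + ν)))) with ha
  have ha0 : 0 ≤ a := by positivity
  -- The source condition contributes the exponent `(s - 1) / (2 (1 + ν))` and `S ^ ((1 + t) / 2)`
  -- contributes `(1 + t) / (2 (1 + ν))`. Their sum is at most `1` since `s + t ≤ 2 (1 + ν)`.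
  have hpow : ∀ φ, ‖powApply (opBB A S) ((s - 1) / (2 * (1 + ν)))
      (boundedPow S (1 / 2) (avgTransAdj A G n (boundedPow S (t / 2) φ)))‖ ≤ a * ‖E φ‖ := by
    intro φ
    refine hH.norm_le_of_coeff ha0 (φ := fun μ => μ ^ ((s + t) / (2 * (1 + ν))) *
      ((n : ℝ)⁻¹ * ∑ k ∈ Finset.Icc 1 n, (α / (μ + α)) ^ k)) (fun μ hμ => ?_) fun μ hμ => ?_
    · rw [hH.eigenProj_powApply (hz _).1]
      simp only [avgTransAdj, smul_apply, sum_apply,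
        map_smul, map_sum, h.eigenProj_transAdj_pow hC hν hα hG hμ]
      rw [← Finset.sum_smul, hS.boundedPow_add (by norm_num) (by positivity),
        show 1 / 2 + t / 2 = (1 + t) / 2 by ring, hE, hH.eigenProj_boundedPow hκ]
      simp only [smul_smul]
      congr 1
      rw [show (s + t) / (2 * (1 + ν)) = (s - 1) / (2 * (1 + ν)) + (1 + t) / 2 / (1 + ν) by
        field_simp; ring, Real.rpow_add hμ]
      ring
    · refine bias_scalar_le hμ hα hn (by positivity) ?_
      rw [div_le_one (by positivity)]
      linarith
  set e := boundedPow S (t / 2) (ContinuousLinearMap.adjoint (avgTransAdj A G n) v) with he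
  -- Duality: the source equation is available only in tested form, so `e` is paired with itself.
  have h1 : ‖e‖ ^ 2 ≤ ‖z‖ * (a * (4 * C * ‖e‖)) := by
    rw [← real_inner_self_eq_norm_sq]
    nth_rewrite 1 [he]
    rw [inner_boundedPow hS.pos (by positivity), ContinuousLinearMap.adjoint_inner_left,
      (hz _).2]
    refine (real_inner_le_norm _ _).trans ?_
    gcongr
    exact (hpow e).trans (by gcongr; exact hEn e)
  rcases (norm_nonneg e).eq_or_lt with h0 | h0
  · rw [← h0]
    positivity
  · refine le_of_mul_le_mul_left ?_ h0
    linarith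

/-- The contribution of one noise to the variance in the direction of an eigenvector of `S`. -/
theorem HilbertScaleLink.variance_le (h : HilbertScaleLink A S C ν) (hC : 1 < C) (hν : 0 < ν)
    (hα : 0 < α) (hτ : 0 ≤ τ) (hτ' : τ ≤ 1) {G : Y →L[ℝ] X}
    (hG : IsGain A S α G) {l : ℝ} (hl : 0 < l) {e : X} (he : S e = l • e) (he1 : ‖e‖ = 1)
    {m n : ℕ} (hn : 1 ≤ n) (hm : m ≤ n) :
    ‖ContinuousLinearMap.adjoint G ((∑ k ∈ Finset.range m, transAdj A G ^ k) e)‖ ^ 2 ≤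
      16 * C ^ 2 * ((n : ℝ) / α) ^ (1 - τ) * l ^ (1 - τ * (1 + ν)) := by
  have hS := h.isInjDiag
  have hH := h.isInjDiag_opBB hC hν
  have hn0 : (0 : ℝ) < n := by exact_mod_cast hn
  obtain ⟨R, hR, hadj, hL⟩ := h.exists_gain_repr hC hν hα hG
  have hτν : 0 ≤ τ * (1 + ν) / 2 := by positivity
  obtain ⟨E, hE, hEn⟩ := h.exists_factor hC hν (r := τ * (1 + ν) / 2) hτν (by nlinarith)
  have hpe : ∀ {p : ℝ}, 0 ≤ p → boundedPow S p e = l ^ p • e := by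
    intro p hp
    rw [← eigenProj_of_eigenvector he, hS.boundedPow_eigenProj hp, Real.rpow_def_of_pos hl,
      mul_comm]
  have hk : τ * (1 + ν) / 2 / (1 + ν) = τ / 2 := by field_simp
  rw [hk] at hE
  -- Only `S ^ (τ (1 + ν) / 2)` is traded for `(B* B) ^ (τ / 2)`. The rest acts on the eigenvector
  -- as a scalar, so its exponent may be negative.
  have hhalf : boundedPow S (1 / 2) e =
      l ^ ((1 - τ * (1 + ν)) / 2) • boundedPow (opBB A S) (τ / 2) (E e) := by
    rw [← hE, hpe (by norm_num), hpe hτν, smul_smul, ← Real.rpow_add hl]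
    congr 2
    ring
  rw [hadj, ← h.norm_opBB_half hC hν]
  have hb : ‖boundedPow (opBB A S) (1 / 2) (R (boundedPow S (1 / 2)
      ((∑ k ∈ Finset.range m, transAdj A G ^ k) e)))‖ ≤
      ((n : ℝ) / α) ^ ((1 - τ) / 2) * ‖l ^ ((1 - τ * (1 + ν)) / 2) • E e‖ := by
    refine hH.norm_le_of_coeff (by positivity) (φ := fun μ => μ ^ ((1 + τ) / 2) *
      ((μ + α)⁻¹ * ∑ k ∈ Finset.range m, (α / (μ + α)) ^ k)) (fun μ hμ => ?_) fun μ hμ =>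
        variance_scalar_le hμ hα hn hm hτ hτ'
    rw [hH.eigenProj_boundedPow (by norm_num), hR μ hμ]
    simp only [sum_apply, map_sum, h.eigenProj_transAdj_pow hC hν hα hG hμ]
    rw [← Finset.sum_smul, hhalf]
    simp only [map_smul, hH.eigenProj_boundedPow (show 0 ≤ τ / 2 by positivity), smul_smul]
    congr 1
    rw [show (1 + τ) / 2 = 1 / 2 + τ / 2 by ring, Real.rpow_add hμ]
    ring
  rw [norm_smul, Real.norm_of_nonneg (by positivity)] at hb
  have hEe : ‖E e‖ ≤ 4 * C := by simpa [he1] using hEn e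
  have hsq : ∀ {b p : ℝ}, 0 < b → (b ^ (p / 2)) ^ 2 = b ^ p := fun hb => by
    rw [← Real.rpow_natCast, ← Real.rpow_mul hb.le]
    norm_num
  calc _ ≤ (((n : ℝ) / α) ^ ((1 - τ) / 2) * (l ^ ((1 - τ * (1 + ν)) / 2) * (4 * C))) ^ 2 := by
        gcongr
        exact hb.trans (by gcongr)
    _ = _ := by
        rw [mul_pow, mul_pow, hsq (by positivity), hsq hl]
        ring

end Deterministic

/-! ### White noise as an `L²` map; images under Hilbert-Schmidt operators -/

section WhiteNoise

variable {X Y Ω : Type*} [NormedAddCommGroup X] [InnerProductSpace ℝ X] [CompleteSpace X]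
  [NormedAddCommGroup Y] [InnerProductSpace ℝ Y] [CompleteSpace Y] [MeasurableSpace Ω]
  {P : Measure Ω} {γ : ℝ}

theorem IsWhiteNoise.memLp {ξ : Y → Ω → ℝ} (hξ : IsWhiteNoise P γ ξ) (φ : Y) :
    MemLp (ξ φ) 2 P :=
  (hξ.gaussian.hasGaussianLaw_eval φ).memLp_two

theorem IsWhiteNoise.inner_toLp {ξ : Y → Ω → ℝ} (hξ : IsWhiteNoise P γ ξ) (φ ψ : Y) :
    ⟪(hξ.memLp φ).toLp (ξ φ), (hξ.memLp ψ).toLp (ξ ψ)⟫_ℝ = γ ^ 2 * ⟪φ, ψ⟫_ℝ := by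
  rw [L2.inner_def, ← hξ.cov φ ψ]
  refine integral_congr_ae ?_
  filter_upwards [(hξ.memLp φ).coeFn_toLp, (hξ.memLp ψ).coeFn_toLp] with ω h1 h2
  rw [h1, h2, real_inner_eq_re_inner, RCLike.inner_apply]
  simp [mul_comm]

theorem eq_of_inner_sub_eq_zero {x y : X} (h : ⟪x - y, x - y⟫_ℝ = 0) : x = y :=
  sub_eq_zero.1 (inner_self_eq_zero.1 h)

/-- A white noise as a bounded linear map into `L²`. -/
theorem IsWhiteNoise.exists_linear {ξ : Y → Ω → ℝ} (hξ : IsWhiteNoise P γ ξ) :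
    ∃ N : Y →L[ℝ] Lp ℝ 2 P, (∀ φ, N φ =ᵐ[P] ξ φ) ∧ ∀ φ, ‖N φ‖ ^ 2 = γ ^ 2 * ‖φ‖ ^ 2 := by
  let f : Y → Lp ℝ 2 P := fun φ => (hξ.memLp φ).toLp (ξ φ)
  have hf : ∀ φ ψ, ⟪f φ, f ψ⟫_ℝ = γ ^ 2 * ⟪φ, ψ⟫_ℝ := hξ.inner_toLp
  have hn : ∀ φ, ‖f φ‖ ^ 2 = γ ^ 2 * ‖φ‖ ^ 2 := fun φ => by
    rw [← real_inner_self_eq_norm_sq, hf, real_inner_self_eq_norm_sq]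
  -- Linearity follows from the covariance alone: the defect has zero `L²` norm.
  let L : Y →ₗ[ℝ] Lp ℝ 2 P :=
    { toFun := f
      map_add' := fun φ ψ => eq_of_inner_sub_eq_zero <| by
        simp only [inner_sub_left, inner_sub_right, inner_add_left, inner_add_right, hf]
        ring
      map_smul' := fun c φ => eq_of_inner_sub_eq_zero <| by
        simp only [inner_sub_left, inner_sub_right, real_inner_smul_left, real_inner_smul_right,
          hf, RingHom.id_apply]
        ring }
  refine ⟨L.mkContinuous |γ| fun φ => ?_, fun φ => (hξ.memLp φ).coeFn_toLp, hn⟩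
  refine abs_le_of_sq_le_sq' (le_of_eq ?_) (by positivity) |>.2
  rw [mul_pow, sq_abs]
  exact hn φ

theorem IsWhiteNoise.add_ae {ξ : Y → Ω → ℝ} (hξ : IsWhiteNoise P γ ξ) (φ ψ : Y) :
    ∀ᵐ ω ∂P, ξ (φ + ψ) ω = ξ φ ω + ξ ψ ω := by
  obtain ⟨N, hN, -⟩ := hξ.exists_linear
  have h := Lp.coeFn_add (N φ) (N ψ)
  rw [← map_add] at h
  filter_upwards [h, hN φ, hN ψ, hN (φ + ψ)] with ω h1 h2 h3 h4
  rw [← h4, h1, Pi.add_apply, h2, h3]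

theorem IsWhiteNoise.zero_ae {ξ : Y → Ω → ℝ} (hξ : IsWhiteNoise P γ ξ) :
    ∀ᵐ ω ∂P, ξ 0 ω = 0 := by
  filter_upwards [hξ.add_ae 0 0] with ω h
  rw [add_zero] at h
  linarith

/-- `g ↦ g b` as an isometry of `L²` spaces, for a unit vector `b`. -/
theorem norm_compLpL_toSpanSingleton {b : X} (hb : ‖b‖ = 1) (g : Lp ℝ 2 P) :
    ‖(ContinuousLinearMap.toSpanSingleton ℝ b).compLpL 2 P g‖ = ‖g‖ := by
  rw [Lp.norm_def, Lp.norm_def]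
  congr 1
  refine eLpNorm_congr_norm_ae ?_
  filter_upwards [(ContinuousLinearMap.toSpanSingleton ℝ b).coeFn_compLpL g] with ω h
  rw [h, ContinuousLinearMap.toSpanSingleton_apply, norm_smul, hb, mul_one]

/-- The image of a white noise under a Hilbert-Schmidt operator is a random vector. -/
theorem IsWhiteNoise.exists_randomVector {ξ : Y → Ω → ℝ} (hξ : IsWhiteNoise P γ ξ) {ι : Type*}
    (b : HilbertBasis ι ℝ X) (G : Y →L[ℝ] X)
    (hG : Summable fun i => ‖ContinuousLinearMap.adjoint G (b i)‖ ^ 2) :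
    ∃ ζ : Ω → X, AEStronglyMeasurable ζ P ∧
      ∀ x, ∀ᵐ ω ∂P, ⟪x, ζ ω⟫_ℝ = ξ (ContinuousLinearMap.adjoint G x) ω := by
  obtain ⟨N, hN, hNn⟩ := hξ.exists_linear
  let V : ι → Lp ℝ 2 P →ₗᵢ[ℝ] Lp X 2 P := fun i =>
    { toLinearMap := ((ContinuousLinearMap.toSpanSingleton ℝ (b i)).compLpL 2 P).toLinearMap
      norm_map' := norm_compLpL_toSpanSingleton (b.orthonormal.1 i) }
  have hVc : ∀ i g, V i g =ᵐ[P] fun ω => g ω • b i := fun i g =>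
    (ContinuousLinearMap.toSpanSingleton ℝ (b i)).coeFn_compLpL g
  have hV : OrthogonalFamily ℝ (fun _ : ι => Lp ℝ 2 P) V := by
    intro i j hij g g'
    rw [L2.inner_def]
    refine integral_eq_zero_of_ae ?_
    filter_upwards [hVc i g, hVc j g'] with ω h1 h2
    rw [h1, h2, real_inner_smul_left, real_inner_smul_right, b.orthonormal.2 hij]
    simp
  -- The terms are orthogonal in `L²(Ω; X)`, so the Hilbert-Schmidt condition on `G` is exactly what
  -- yields convergence.
  have hsum : Summable fun i => V i (N (ContinuousLinearMap.adjoint G (b i))) := by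
    rw [hV.summable_iff_norm_sq_summable]
    simp only [hNn]
    exact hG.mul_left _
  refine ⟨(∑' i, V i (N (ContinuousLinearMap.adjoint G (b i))) : Lp X 2 P),
    Lp.aestronglyMeasurable _, fun x => ?_⟩
  set ζ : Lp X 2 P := ∑' i, V i (N (ContinuousLinearMap.adjoint G (b i)))
  have h1 : HasSum (fun i => ⟪b i, x⟫_ℝ • N (ContinuousLinearMap.adjoint G (b i)))
      ((innerSL ℝ x).compLpL 2 P ζ) := by
    convert! hsum.hasSum.mapL ((innerSL ℝ x).compLpL 2 P) using 2 with i
    refine Lp.ext ?_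
    filter_upwards [(innerSL ℝ x).coeFn_compLpL (V i (N (ContinuousLinearMap.adjoint G (b i)))),
      hVc i (N (ContinuousLinearMap.adjoint G (b i))),
      Lp.coeFn_smul ⟪b i, x⟫_ℝ (N (ContinuousLinearMap.adjoint G (b i)))] with ω h1 h2 h3
    rw [h1, h2, h3, Pi.smul_apply, innerSL_apply_apply, real_inner_smul_right, smul_eq_mul,
      real_inner_comm, mul_comm]
  have h2 : HasSum (fun i => ⟪b i, x⟫_ℝ • N (ContinuousLinearMap.adjoint G (b i)))
      (N (ContinuousLinearMap.adjoint G x)) := by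
    simpa [b.repr_apply_apply] using
      (b.hasSum_repr x).mapL (N ∘L ContinuousLinearMap.adjoint G)
  have h3 := h1.unique h2
  have h4 := (innerSL ℝ x).coeFn_compLpL ζ
  rw [h3] at h4
  filter_upwards [h4, hN (ContinuousLinearMap.adjoint G x)] with ω h5 h6
  rw [← h6, h5, innerSL_apply_apply]

theorem IsIIDWhiteNoise.integral_mul {η : ℕ → Y → Ω → ℝ} (hη : IsIIDWhiteNoise P γ η) {i j : ℕ}
    (hij : i ≠ j) (φ ψ : Y) : ∫ ω, η i φ ω * η j ψ ω ∂P = 0 := by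
  have h := (hη.indep.indepFun hij).comp (measurable_pi_apply φ) (measurable_pi_apply ψ)
  have h2 := h.integral_fun_mul_eq_mul_integral
    ((hη.whiteNoise i).measurable φ).aestronglyMeasurable
    ((hη.whiteNoise j).measurable ψ).aestronglyMeasurable
  simp only [Function.comp_apply] at h2
  rw [h2, (hη.whiteNoise i).mean, zero_mul]

/-- Second moment of a constant plus a combination of independent noises. -/
theorem IsIIDWhiteNoise.second_moment [IsProbabilityMeasure P] {η : ℕ → Y → Ω → ℝ}
    (hη : IsIIDWhiteNoise P γ η) (c a : ℝ) (n : ℕ) (φ : ℕ → Y) :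
    Integrable (fun ω => (c + a * ∑ j ∈ Finset.range n, η j (φ j) ω) ^ 2) P ∧
    ∫ ω, (c + a * ∑ j ∈ Finset.range n, η j (φ j) ω) ^ 2 ∂P =
      c ^ 2 + a ^ 2 * (γ ^ 2 * ∑ j ∈ Finset.range n, ‖φ j‖ ^ 2) := by
  have hL : ∀ j, MemLp (η j (φ j)) 2 P := fun j => (hη.whiteNoise j).memLp (φ j)
  have hI : ∀ j, Integrable (η j (φ j)) P := fun j => (hL j).integrable one_le_two
  have hII : ∀ i j, Integrable (fun ω => η i (φ i) ω * η j (φ j) ω) P := fun i j =>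
    (hL i).integrable_mul (hL j)
  have hZ : Integrable (fun ω => ∑ j ∈ Finset.range n, η j (φ j) ω) P :=
    integrable_finsetSum _ fun j _ => hI j
  have hZZ : Integrable (fun ω => ∑ i ∈ Finset.range n, ∑ j ∈ Finset.range n,
      η i (φ i) ω * η j (φ j) ω) P :=
    integrable_finsetSum _ fun i _ => integrable_finsetSum _ fun j _ => hII i j
  have he : (fun ω => (c + a * ∑ j ∈ Finset.range n, η j (φ j) ω) ^ 2) = fun ω =>
      (c ^ 2 + 2 * c * a * ∑ j ∈ Finset.range n, η j (φ j) ω) +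
        a ^ 2 * ∑ i ∈ Finset.range n, ∑ j ∈ Finset.range n, η i (φ i) ω * η j (φ j) ω := by
    funext ω
    rw [← Finset.sum_mul_sum]
    ring
  rw [he]
  have h1 : Integrable (fun ω => c ^ 2 + 2 * c * a * ∑ j ∈ Finset.range n, η j (φ j) ω) P :=
    (integrable_const _).add (hZ.const_mul _)
  refine ⟨h1.add (hZZ.const_mul _), ?_⟩
  rw [integral_add h1 (hZZ.const_mul _), integral_add (integrable_const _) (hZ.const_mul _),
    integral_const_mul, integral_const_mul, integral_finsetSum _ fun j _ => hI j,
    integral_finsetSum _ fun i _ => integrable_finsetSum _ fun j _ => hII i j]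
  simp only [(hη.whiteNoise _).mean, Finset.sum_const_zero, mul_zero, add_zero, integral_const,
    probReal_univ, one_smul]
  congr 2
  rw [Finset.mul_sum]
  refine Finset.sum_congr rfl fun i hi => ?_
  rw [integral_finsetSum _ fun j _ => hII i j, Finset.sum_eq_single_of_mem i hi fun j _ hj =>
    hη.integral_mul hj.symm _ _, (hη.whiteNoise i).cov, real_inner_self_eq_norm_sq]

end WhiteNoise

/-! ### Error representation for the iterates and their average -/

section Filter

variable {X Y Ω : Type*} [NormedAddCommGroup X] [InnerProductSpace ℝ X] [CompleteSpace X]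
  [NormedAddCommGroup Y] [InnerProductSpace ℝ Y] [CompleteSpace Y] [MeasurableSpace Ω]
  {P : Measure Ω} {γ : ℝ} {A : X →L[ℝ] Y} {G : Y →L[ℝ] X} {η : ℕ → Y → Ω → ℝ} {u₀ uTrue : X}
  {u : ℕ → Ω → X}

theorem exists_isFilterSequence (A : X →L[ℝ] Y) (u₀ uTrue : X)
    (h : ∀ k, ∃ ζ : Ω → X, AEStronglyMeasurable ζ P ∧
      ∀ x, ∀ᵐ ω ∂P, ⟪x, ζ ω⟫_ℝ = η k (ContinuousLinearMap.adjoint G x) ω) :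
    ∃ u, IsFilterSequence P A G (observation A uTrue η) u₀ u := by
  choose ζ hm hζ using h
  let u : ℕ → Ω → X := fun n => Nat.rec (fun _ => u₀)
    (fun n un ω => G (A uTrue) + ζ n ω + (un ω - G (A (un ω)))) n
  have hu : ∀ n ω, u (n + 1) ω = G (A uTrue) + ζ n ω + (u n ω - G (A (u n ω))) := fun n ω => rfl
  refine ⟨u, fun n => ?_, Eventually.of_forall fun ω => rfl, fun n x => ?_⟩
  · induction n with
    | zero => exact aestronglyMeasurable_const
    | succ n ih =>
      refine AEStronglyMeasurable.add (aestronglyMeasurable_const.add (hm n)) (ih.sub ?_)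
      exact (G ∘L A).continuous.comp_aestronglyMeasurable ih
  · filter_upwards [hζ n x] with ω h
    rw [hu, inner_add_right, inner_add_right, h, observation,
      ContinuousLinearMap.adjoint_inner_right, real_inner_comm x]

/-- The error of the `n`-th iterate in the direction `x`. -/
theorem IsFilterSequence.inner_error
    (hu : IsFilterSequence P A G (observation A uTrue η) u₀ u) (n : ℕ) (x : X) :
    ∀ᵐ ω ∂P, ⟪x, u n ω - uTrue⟫_ℝ = ⟪(transAdj A G ^ n) x, u₀ - uTrue⟫_ℝ +
      ∑ j ∈ Finset.range n,
        η j (ContinuousLinearMap.adjoint G ((transAdj A G ^ (n - 1 - j)) x)) ω := by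
  induction n generalizing x with
  | zero =>
    filter_upwards [hu.init] with ω h
    simp [h]
  | succ n ih =>
    filter_upwards [ih (transAdj A G x), hu.step n x] with ω h1 h2
    have h3 : ⟪x, u (n + 1) ω - uTrue⟫_ℝ =
        ⟪transAdj A G x, u n ω - uTrue⟫_ℝ + η n (ContinuousLinearMap.adjoint G x) ω := by
      rw [inner_sub_right, h2, observation, ContinuousLinearMap.adjoint_inner_right,
        inner_transAdj]
      simp only [map_sub, inner_sub_right, real_inner_comm x (G (A uTrue))]
      ring
    rw [h3, h1, Finset.sum_range_succ, pow_succ, mul_apply_eq_comp, Nat.add_sub_cancel,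
      Nat.sub_self, pow_zero, one_apply_eq_self, ← add_assoc]
    congr 2
    -- `η j` enters at step `j + 1` and is propagated `n - 1 - j` times; `j < n` keeps the truncated
    -- subtraction exact.
    refine Finset.sum_congr rfl fun j hj => ?_
    rw [← mul_apply_eq_comp, ← pow_succ,
      show n - 1 - j + 1 = n - j by have := Finset.mem_range.1 hj; omega]

/-- The accumulated error of the first `n` iterates in the direction `x`. -/
theorem IsFilterSequence.inner_sum_error (hη : IsIIDWhiteNoise P γ η)
    (hu : IsFilterSequence P A G (observation A uTrue η) u₀ u) (n : ℕ) (x : X) :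
    ∀ᵐ ω ∂P, ⟪x, ∑ k ∈ Finset.Icc 1 n, (u k ω - uTrue)⟫_ℝ =
      ⟪(∑ k ∈ Finset.Icc 1 n, transAdj A G ^ k) x, u₀ - uTrue⟫_ℝ +
      ∑ j ∈ Finset.range n, η j (ContinuousLinearMap.adjoint G
        ((∑ i ∈ Finset.range (n - j), transAdj A G ^ i) x)) ω := by
  induction n with
  | zero => simp
  | succ n ih =>
    -- The noise is additive only almost surely for each pair of arguments; countably many null sets
    -- are collected.
    have hadd : ∀ᵐ ω ∂P, ∀ j, η j (ContinuousLinearMap.adjoint G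
        ((∑ i ∈ Finset.range (n - j), transAdj A G ^ i) x) +
          ContinuousLinearMap.adjoint G ((transAdj A G ^ (n - j)) x)) ω =
        η j (ContinuousLinearMap.adjoint G
          ((∑ i ∈ Finset.range (n - j), transAdj A G ^ i) x)) ω +
        η j (ContinuousLinearMap.adjoint G ((transAdj A G ^ (n - j)) x)) ω :=
      ae_all_iff.2 fun j => (hη.whiteNoise j).add_ae _ _
    filter_upwards [ih, hu.inner_error (n + 1) x, hadd, (hη.whiteNoise n).zero_ae]
      with ω h1 h2 h3 h4
    rw [Finset.sum_Icc_succ_top (by omega), Finset.sum_Icc_succ_top (by omega), inner_add_right,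
      h1, h2, add_apply, inner_add_left, add_add_add_comm]
    congr 1
    -- The added term `j = n` has an empty inner sum, and `η n 0 = 0` almost surely.
    have h5 : ∑ j ∈ Finset.range n, η j (ContinuousLinearMap.adjoint G
        ((∑ i ∈ Finset.range (n - j), transAdj A G ^ i) x)) ω =
        ∑ j ∈ Finset.range (n + 1), η j (ContinuousLinearMap.adjoint G
        ((∑ i ∈ Finset.range (n - j), transAdj A G ^ i) x)) ω := by
      rw [Finset.sum_range_succ]
      simp [h4]
    rw [h5, ← Finset.sum_add_distrib]
    refine Finset.sum_congr rfl fun j hj => ?_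
    have hj' := Finset.mem_range.1 hj
    rw [Nat.add_sub_cancel, ← h3 j, ← map_add, ← add_apply, ← Finset.sum_range_succ,
      show n - j + 1 = n + 1 - j by omega]

theorem IsFilterSequence.inner_iterAvg (hη : IsIIDWhiteNoise P γ η)
    (hu : IsFilterSequence P A G (observation A uTrue η) u₀ u) {n : ℕ} (hn : 1 ≤ n) (x : X) :
    ∀ᵐ ω ∂P, ⟪x, iterAvg u n ω - uTrue⟫_ℝ = ⟪avgTransAdj A G n x, u₀ - uTrue⟫_ℝ +
      (n : ℝ)⁻¹ * ∑ j ∈ Finset.range n, η j (ContinuousLinearMap.adjoint G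
        ((∑ i ∈ Finset.range (n - j), transAdj A G ^ i) x)) ω := by
  have hn0 : (n : ℝ) ≠ 0 := by positivity
  filter_upwards [hu.inner_sum_error hη n x] with ω h
  have h1 : iterAvg u n ω - uTrue = (n : ℝ)⁻¹ • ∑ k ∈ Finset.Icc 1 n, (u k ω - uTrue) := by
    rw [Finset.sum_sub_distrib, smul_sub, iterAvg, Finset.sum_const, Nat.card_Icc,
      Nat.add_sub_cancel, ← Nat.cast_smul_eq_nsmul ℝ, smul_smul, inv_mul_cancel₀ hn0, one_smul]
  rw [h1, real_inner_smul_right, h, avgTransAdj, smul_apply, real_inner_smul_left, mul_add]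

theorem IsFilterSequence.second_moment [IsProbabilityMeasure P] (hη : IsIIDWhiteNoise P γ η)
    (hu : IsFilterSequence P A G (observation A uTrue η) u₀ u) {n : ℕ} (hn : 1 ≤ n) (x : X) :
    Integrable (fun ω => ⟪x, iterAvg u n ω - uTrue⟫_ℝ ^ 2) P ∧
    ∫ ω, ⟪x, iterAvg u n ω - uTrue⟫_ℝ ^ 2 ∂P =
      ⟪x, ContinuousLinearMap.adjoint (avgTransAdj A G n) (u₀ - uTrue)⟫_ℝ ^ 2 +
      (n : ℝ)⁻¹ ^ 2 * (γ ^ 2 * ∑ j ∈ Finset.range n, ‖ContinuousLinearMap.adjoint G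
        ((∑ i ∈ Finset.range (n - j), transAdj A G ^ i) x)‖ ^ 2) := by
  have h := hη.second_moment ⟪avgTransAdj A G n x, u₀ - uTrue⟫_ℝ (n : ℝ)⁻¹ n fun j =>
    ContinuousLinearMap.adjoint G ((∑ i ∈ Finset.range (n - j), transAdj A G ^ i) x)
  have he : (fun ω => ⟪x, iterAvg u n ω - uTrue⟫_ℝ ^ 2) =ᵐ[P] fun ω =>
      (⟪avgTransAdj A G n x, u₀ - uTrue⟫_ℝ +
      (n : ℝ)⁻¹ * ∑ j ∈ Finset.range n, η j (ContinuousLinearMap.adjoint G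
        ((∑ i ∈ Finset.range (n - j), transAdj A G ^ i) x)) ω) ^ 2 := by
    filter_upwards [hu.inner_iterAvg hη hn x] with ω h
    rw [h]
  refine ⟨h.1.congr he.symm, ?_⟩
  rw [integral_congr_ae he, h.2, ContinuousLinearMap.adjoint_inner_right]

/-- Tonelli in extended nonnegative reals, so integrability of the sum is a conclusion. -/
theorem integrable_and_integral_le_of_hasSum {ι : Type*} [Countable ι] {f : ι → Ω → ℝ}
    {F : Ω → ℝ} (hf : ∀ i ω, 0 ≤ f i ω) (hfi : ∀ i, Integrable (f i) P)
    (hF : ∀ ω, HasSum (fun i => f i ω) (F ω)) (hFm : AEStronglyMeasurable F P) {g : ι → ℝ} {c : ℝ}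
    (hfg : ∀ i, ∫ ω, f i ω ∂P ≤ g i) (hg : HasSum g c) :
    Integrable F P ∧ ∫ ω, F ω ∂P ≤ c := by
  have hF0 : ∀ ω, 0 ≤ F ω := fun ω => (hF ω).nonneg fun i => hf i ω
  have hg0 : ∀ i, 0 ≤ g i := fun i => (integral_nonneg (hf i)).trans (hfg i)
  have hle : ∫⁻ ω, ENNReal.ofReal (F ω) ∂P ≤ ENNReal.ofReal c := by
    calc ∫⁻ ω, ENNReal.ofReal (F ω) ∂P = ∫⁻ ω, ∑' i, ENNReal.ofReal (f i ω) ∂P := by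
          refine lintegral_congr fun ω => ?_
          rw [← (hF ω).tsum_eq, ENNReal.ofReal_tsum_of_nonneg (fun i => hf i ω) (hF ω).summable]
      _ = ∑' i, ∫⁻ ω, ENNReal.ofReal (f i ω) ∂P :=
          lintegral_tsum fun i => (hfi i).aemeasurable.ennreal_ofReal
      _ ≤ ∑' i, ENNReal.ofReal (g i) := by
          refine ENNReal.tsum_le_tsum fun i => ?_
          rw [← ofReal_integral_eq_lintegral_ofReal (hfi i) (Eventually.of_forall (hf i))]
          exact ENNReal.ofReal_le_ofReal (hfg i)
      _ = ENNReal.ofReal c := by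
          rw [← hg.tsum_eq, ENNReal.ofReal_tsum_of_nonneg hg0 hg.summable]
  refine ⟨(lintegral_ofReal_ne_top_iff_integrable hFm (Eventually.of_forall hF0)).1
    (hle.trans_lt ENNReal.ofReal_lt_top).ne, ?_⟩
  rw [integral_eq_lintegral_of_nonneg_ae (Eventually.of_forall hF0) hFm]
  exact ENNReal.toReal_le_of_le_ofReal (hg.nonneg hg0) hle

end Filter

/-! ### Existence of the iterates and the error bound -/

section Conclusion

variable {X Y Ω : Type*} [NormedAddCommGroup X] [InnerProductSpace ℝ X] [CompleteSpace X]
  [NormedAddCommGroup Y] [InnerProductSpace ℝ Y] [CompleteSpace Y] [MeasurableSpace Ω]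
  {P : Measure Ω} {γ : ℝ} {A : X →L[ℝ] Y} {S : X →L[ℝ] X} {C ν α s t τ : ℝ} {G : Y →L[ℝ] X}
  {η : ℕ → Y → Ω → ℝ} {u₀ uTrue : X} {u : ℕ → Ω → X}

/-- The norm `‖x‖_t` in terms of an eigenbasis. -/
theorem IsInjDiag.hasSum_scaleNorm_sq (hS : IsInjDiag S) (ht : 0 ≤ t) {ι : Type*}
    (b : HilbertBasis ι ℝ X) {l : ι → ℝ} (hl : ∀ i, 0 < l i ∧ S (b i) = l i • b i) (x : X) :
    HasSum (fun i => l i ^ t * ⟪b i, x⟫_ℝ ^ 2) (‖boundedPow S (t / 2) x‖ ^ 2) := by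
  convert! hasSum_inner_sq b (boundedPow S (t / 2) x) using 2 with i
  rw [← inner_boundedPow hS.pos (by positivity), ← eigenProj_of_eigenvector (hl i).2,
    hS.boundedPow_eigenProj (by positivity), real_inner_smul_left, mul_pow, ← Real.exp_nat_mul,
    Real.rpow_def_of_pos (hl i).1]
  congr 2
  push_cast
  ring

theorem HilbertScaleLink.exists_filterSequence [TopologicalSpace.SeparableSpace X]
    (h : HilbertScaleLink A S C ν) (hC : 1 < C) (hν : 0 < ν) (hα : 0 < α) (hG : IsGain A S α G)
    (hη : IsIIDWhiteNoise P γ η) (u₀ uTrue : X) :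
    ∃ u, IsFilterSequence P A G (observation A uTrue η) u₀ u := by
  have hS := h.isInjDiag
  obtain ⟨w, _, b, l, hl⟩ := hS.exists_eigenbasis
  have hsum : Summable l := by
    refine (h.traceClass.2 w b).congr fun i => ?_
    rw [(hl i).2, real_inner_smul_right, real_inner_self_eq_norm_sq, b.orthonormal.1 i]
    ring
  -- The variance bound with `τ = 0` and `m = n = 1` reads `‖G* b i‖ ^ 2 ≤ 16 C ^ 2 l i / α`, so `G`
  -- is Hilbert-Schmidt.
  have hHS : Summable fun i => ‖ContinuousLinearMap.adjoint G (b i)‖ ^ 2 := by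
    refine Summable.of_nonneg_of_le (fun i => by positivity) (fun i => ?_)
      (hsum.mul_left (16 * C ^ 2 * (1 / α)))
    simpa using h.variance_le hC hν hα le_rfl zero_le_one hG (hl i).1 (hl i).2
      (b.orthonormal.1 i) (le_refl 1) (le_refl 1)
  exact exists_isFilterSequence A u₀ uTrue fun k =>
    (hη.whiteNoise k).exists_randomVector b G hHS

theorem HilbertScaleLink.error_le [TopologicalSpace.SeparableSpace X] [IsProbabilityMeasure P]
    (h : HilbertScaleLink A S C ν) (hC : 1 < C) (hν : 0 < ν) (hs : 0 ≤ s) (hs' : s ≤ ν + 2)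
    (ht : 0 ≤ t) (ht' : t ≤ ν) (hτ : 0 ≤ τ) (hτ' : τ ≤ 1)
    (htr : IsTraceClassPow S (t + 1 - τ * (1 + ν))) {z : X}
    (hz : SolvesAux A S ν s (u₀ - uTrue) z) (hα : 0 < α) (hG : IsGain A S α G)
    (hη : IsIIDWhiteNoise P γ η) (hu : IsFilterSequence P A G (observation A uTrue η) u₀ u)
    {n : ℕ} (hn : 1 ≤ n) :
    Integrable (fun ω => scaleNorm S t (iterAvg u n ω - uTrue) ^ 2) P ∧
    ∫ ω, scaleNorm S t (iterAvg u n ω - uTrue) ^ 2 ∂P ≤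
      16 * C ^ 2 * (((n : ℝ) / α) ^ (-((s + t) / (1 + ν))) * ‖z‖ ^ 2 +
        γ ^ 2 / α * opTrace (boundedPow S (t + 1 - τ * (1 + ν))) * ((n : ℝ) / α) ^ (-τ)) := by
  have hS := h.isInjDiag
  have hn0 : (0 : ℝ) < n := by exact_mod_cast hn
  obtain ⟨w, _, b, l, hl⟩ := hS.exists_eigenbasis
  simp only [scaleNorm_eq hS.pos ht]
  set v := ContinuousLinearMap.adjoint (avgTransAdj A G n) (u₀ - uTrue) with hv
  set a := (n : ℝ)⁻¹ * γ ^ 2 * (16 * C ^ 2 * ((n : ℝ) / α) ^ (1 - τ)) with ha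
  have hm : AEStronglyMeasurable
      (fun ω => ‖boundedPow S (t / 2) (iterAvg u n ω - uTrue)‖ ^ 2) P := by
    have h1 : AEStronglyMeasurable (fun ω => ∑ k ∈ Finset.Icc 1 n, u k ω) P :=
      Finset.aestronglyMeasurable_fun_sum _ fun k _ => hu.measurable k
    have h2 : AEStronglyMeasurable (fun ω => iterAvg u n ω - uTrue) P :=
      (h1.const_smul (n : ℝ)⁻¹).sub aestronglyMeasurable_const
    exact ((boundedPow S (t / 2)).continuous.comp_aestronglyMeasurable h2).norm.pow 2
  -- Majorant of the second moments along the eigenbasis: the bias parts sum to `‖S ^ (t/2) v‖ ^ 2`,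
  -- the noise parts to `a` times the trace.
  have hg := (hS.hasSum_scaleNorm_sq ht b hl v).add
    ((hasSum_rpow_opTrace b hS hl htr).mul_left a)
  have key := integrable_and_integral_le_of_hasSum
    (f := fun i ω => l i ^ t * ⟪b i, iterAvg u n ω - uTrue⟫_ℝ ^ 2)
    (fun i ω => mul_nonneg (Real.rpow_nonneg (hl i).1.le _) (sq_nonneg _))
    (fun i => (hu.second_moment hη hn (b i)).1.const_mul _)
    (fun ω => hS.hasSum_scaleNorm_sq ht b hl _) hm (fun i => ?_) hg
  · refine ⟨key.1, key.2.trans ?_⟩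
    have hb := h.bias_le hC hν hα hs hs' ht ht' hG hz hn
    have hb2 : ‖boundedPow S (t / 2) v‖ ^ 2 ≤
        16 * C ^ 2 * (((n : ℝ) / α) ^ (-((s + t) / (1 + ν))) * ‖z‖ ^ 2) := by
      calc ‖boundedPow S (t / 2) v‖ ^ 2
          ≤ (4 * C * ((n : ℝ) / α) ^ (-((s + t) / (2 * (1 + ν)))) * ‖z‖) ^ 2 := by gcongr
        _ = 16 * C ^ 2 * ((((n : ℝ) / α) ^ (-((s + t) / (2 * (1 + ν))))) ^ 2 * ‖z‖ ^ 2) := by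
            ring
        _ = _ := by
            rw [← Real.rpow_natCast (((n : ℝ) / α) ^ _), ← Real.rpow_mul (by positivity)]
            congr 4
            push_cast
            field_simp
    have ha2 : a = 16 * C ^ 2 * (γ ^ 2 / α * ((n : ℝ) / α) ^ (-τ)) := by
      rw [ha, sub_eq_add_neg, Real.rpow_add (by positivity), Real.rpow_one]
      field_simp
    rw [ha2]
    linarith
  · rw [integral_const_mul, (hu.second_moment hη hn (b i)).2, mul_add]
    refine add_le_add le_rfl ?_
    have hli := (hl i).1
    -- The bound is uniform in `j`, so the `n` independent noises cancel one of the two factors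
    -- `n⁻¹`.
    have hsum : ∑ j ∈ Finset.range n, ‖ContinuousLinearMap.adjoint G
        ((∑ i ∈ Finset.range (n - j), transAdj A G ^ i) (b i))‖ ^ 2 ≤
        n * (16 * C ^ 2 * ((n : ℝ) / α) ^ (1 - τ) * l i ^ (1 - τ * (1 + ν))) := by
      refine (Finset.sum_le_card_nsmul _ _ _ fun j _ => h.variance_le hC hν hα hτ hτ' hG hli
        (hl i).2 (b.orthonormal.1 i) hn (Nat.sub_le n j)).trans_eq ?_
      rw [Finset.card_range, nsmul_eq_mul]
    calc _ ≤ l i ^ t * ((n : ℝ)⁻¹ ^ 2 * (γ ^ 2 *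
          (n * (16 * C ^ 2 * ((n : ℝ) / α) ^ (1 - τ) * l i ^ (1 - τ * (1 + ν)))))) := by gcongr
      _ = _ := by
        rw [ha, add_sub_assoc, Real.rpow_add hli]
        field_simp

end Conclusion

end ThreeDVAR

theorem mainTheorem1 (C ν s t τ : ℝ) (hC : 1 < C) (hν : 0 < ν) (hs : 0 ≤ s) (hs' : s ≤ ν + 2)
    (ht : 0 ≤ t) (ht' : t ≤ ν) (hτ : 0 ≤ τ) (hτ' : τ ≤ 1) :
    ∃ K : ℝ, 0 < K ∧
      ∀ (X Y : Type*)
        [NormedAddCommGroup X] [InnerProductSpace ℝ X] [CompleteSpace X]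
        [TopologicalSpace.SeparableSpace X]
        [NormedAddCommGroup Y] [InnerProductSpace ℝ Y] [CompleteSpace Y]
        [TopologicalSpace.SeparableSpace Y]
        (A : X →L[ℝ] Y) (S : X →L[ℝ] X),
        HilbertScaleLink A S C ν →
        IsTraceClassPow S (t + 1 - τ * (1 + ν)) →
        ∀ u₀ uTrue : X, u₀ - uTrue ∈ powDom S (-(s / 2)) →
          (∃! z₀, SolvesAux A S ν s (u₀ - uTrue) z₀) ∧
          ∀ z₀, SolvesAux A S ν s (u₀ - uTrue) z₀ →
          ∀ α : ℝ, 0 < α →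
            (∃! G, IsGain A S α G) ∧
            ∀ G, IsGain A S α G →
            ∀ (γ : ℝ) (Ω : Type*) [MeasurableSpace Ω] (P : Measure Ω) [IsProbabilityMeasure P]
              (η : ℕ → Y → Ω → ℝ),
              IsIIDWhiteNoise P γ η →
              (∃ u, IsFilterSequence P A G (observation A uTrue η) u₀ u) ∧
              ∀ u, IsFilterSequence P A G (observation A uTrue η) u₀ u →
              ∀ n : ℕ, 1 ≤ n →
                Integrable (fun ω => scaleNorm S t (iterAvg u n ω - uTrue) ^ 2) P ∧
                ∫ ω, scaleNorm S t (iterAvg u n ω - uTrue) ^ 2 ∂P ≤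
                  K * (((n : ℝ) / α) ^ (-((s + t) / (1 + ν))) * ‖z₀‖ ^ 2 +
                    γ ^ 2 / α * opTrace (boundedPow S (t + 1 - τ * (1 + ν))) *
                      ((n : ℝ) / α) ^ (-τ)) := by
  -- The square of the bound `4 C` on the factor `E`.
  refine ⟨16 * C ^ 2, by positivity, ?_⟩
  intro X Y _ _ _ _ _ _ _ _ A S h htr u₀ uTrue hv
  refine ⟨h.existsUnique_solvesAux hC hν hs hs' hv, fun z hz α hα => ?_⟩
  refine ⟨h.isInjDiag.existsUnique_isGain hα, fun G hG γ Ω _ P _ η hη => ?_⟩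
  exact ⟨h.exists_filterSequence hC hν hα hG hη u₀ uTrue, fun u hu n hn =>
    h.error_le hC hν hs hs' ht ht' hτ hτ' htr hz hα hG hη hu hn⟩
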